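/- Let $X,Y$ be finite nonempty sets, $Z$ a set and $f:X\times Y\to Z$. **Forbidden submatrices.** The communication matrix of $f$ has rows indexed by $X$, columns indexed by $Y$ and entry $f(x,y)$ at $(x,y)$. For a matrix $M$, write $x\equiv' x'$ for two rows if $M_{x,y}=M_{x',y}$ for some column $y$, and let $\equiv$ be the transitive closure of $\equiv'$; define the analogous relations for columns. $M$ is *forbidden* if all its rows are equivalent, all its columns are equivalent, and its entries are not all the same. A submatrix is given by a set $A\subseteq X$ of rows and a set $B\subseteq Y$ of columns, and the equivalences are taken inside the submatrix. **Quantum protocols.** Al holds a classical input $x\in X$, Bob holds $y\in Y$, and finitely many qubits, each owned by one of the players, start in the state $|0\cdots0\rangle$. There are finitely many rounds. In each round one player applies to the qubits he owns a unitary transformation depending on his input and the round, and then passes some of his qubits to the other player. The inputs are never erased, and there is no public coin. At the end a player measures his qubits in the computational basis and determines a result from the outcome and his input. The protocol computes $f$ with error $\varepsilon$ for a player if, for all $(x,y)$, the result of this player is $f(x,y)$ with probability at least $1-\varepsilon$. **Classical protocols.** Each player draws the value of private coins from a finite probability space. In each round one player sends a bit string determined by his input, his coins and the previous messages; at the end each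 player determines a result from his input, his coins and all messages. The protocol is deterministic if the coins of both players take only one value. **Privacy loss.** For a distribution $\mu$ of the inputs $(X,Y)$ and a time $t$ (after any number of rounds), let $A$ and $B$ be what Al and Bob hold at time $t$ besides the inputs (the qubits they own; in the classical case their coins and the messages so far). The information divulged to Bob is $I(B:X\mid Y,f(X,Y))$, and the information divulged to Al is $I(A:Y\mid X,f(X,Y))$, where $I(P:Q\mid C)=S(PC)+S(QC)-S(C)-S(PQC)$ with the von Neumann entropy $S$ (the Shannon entropy in the classical case). The privacy loss of a protocol is the supremum of these quantities over all $t$, both players and all $\mu$. **Theorem.** (a) If the communication matrix of $f$ contains a forbidden submatrix, then no quantum protocol with privacy loss $0$ computes $f$ with an error $\varepsilon<1/2$, not even for only one of the players. (b) The following are equivalent, where "computes $f$" means that it does so for both players: 1. the communication matrix of $f$ contains no forbidden submatrix; 2. some deterministic protocol with privacy loss $0$ computes $f$ without error; 3. some classical randomized protocol with privacy loss $0$ computes $f$ without error; 4. for some $\varepsilon<1/2$, some classical randomized protocol with privacy loss $0$ computes $f$ with error $\varepsilon$; 5. some quantum protocol with privacy loss $0$ computes $f$ without error; 6. for some $\varepsilon<1/2$,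 some quantum protocol with privacy loss $0$ computes $f$ with error $\varepsilon$. -/

import Mathlib

open scoped BigOperators

noncomputable section

/-! # Communication matrices and forbidden submatrices -/

/-- `x ≡' x'`: the rows `x` and `x'` of `M` agree in some column. -/
def RowRel {R C Z : Type*} (M : Matrix R C Z) (x x' : R) : Prop :=
  ∃ y, M x y = M x' y

/-- `y ≡' y'`: the columns `y` and `y'` of `M` agree in some row. -/
def ColRel {R C Z : Type*} (M : Matrix R C Z) (y y' : C) : Prop :=
  ∃ x, M x y = M x y'

/-- All entries of `M` are the same. -/
def IsMonochromatic {R C Z : Type*} (M : Matrix R C Z) : Prop :=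
  ∀ x x' y y', M x y = M x' y'

/-- All rows are equivalent and all columns are equivalent (for the transitive closures of the
relations above), and the matrix is not monochromatic. -/
def IsForbidden {R C Z : Type*} (M : Matrix R C Z) : Prop :=
  (∀ x x', Relation.TransGen (RowRel M) x x') ∧
  (∀ y y', Relation.TransGen (ColRel M) y y') ∧
  ¬ IsMonochromatic M

/-- The communication matrix of `f` has a forbidden submatrix, with rows `A` and columns `B`. -/
def ContainsForbidden {X Y Z : Type*} (f : X → Y → Z) : Prop :=
  ∃ (A : Set X) (B : Set Y),
    IsForbidden ((Matrix.of f).submatrix (fun a : A => (a : X)) (fun b : B => (b : Y)))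

/-- The two players. -/
inductive Player where
  | al : Player
  | bob : Player
  deriving DecidableEq

/-! # Quantum information -/

/-- The von Neumann entropy `-∑ λ log₂ λ`, over the multiset of all eigenvalues of `ρ`. -/
def vonNeumannEntropy {ι : Type*} [Fintype ι] [DecidableEq ι] (ρ : Matrix ι ι ℂ) : ℝ :=
  (ρ.charpoly.roots.map (fun z : ℂ => -(z.re * Real.logb 2 z.re))).sum

/-- `I(P : Q | C) = S(PC) + S(QC) - S(C) - S(PQC)` for a state `ρ` on `P ⊗ Q ⊗ C`, with the
reduced states given by partial traces. -/
def quantumCondMutualInfo {P Q C : Type*} [Fintype P] [Fintype Q] [Fintype C]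
    [DecidableEq P] [DecidableEq Q] [DecidableEq C]
    (ρ : Matrix (P × Q × C) (P × Q × C) ℂ) : ℝ :=
  vonNeumannEntropy
      (Matrix.of fun (i j : P × C) => ∑ q : Q, ρ (i.1, q, i.2) (j.1, q, j.2))
    + vonNeumannEntropy
      (Matrix.of fun (i j : Q × C) => ∑ p : P, ρ (p, i.1, i.2) (p, j.1, j.2))
    - vonNeumannEntropy
      (Matrix.of fun (i j : C) => ∑ p : P, ∑ q : Q, ρ (p, q, i) (p, q, j))
    - vonNeumannEntropy ρ

open Classical in
/-- The information `I(R : O | K, g(O, K))`, where `O` (the other player's input) and `K` (the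
player's own input) are distributed according to `μ`, and the player's quantum register `R` is in
the state `σ o k` on inputs `o, k`. It is taken in the joint state
`∑ μ(o, k) σ(o, k) ⊗ |o⟩⟨o| ⊗ |k⟩⟨k| ⊗ |g(o, k)⟩⟨g(o, k)|`. -/
def quantumDivulged {R O K Z : Type*} [Fintype R] [Fintype O] [Fintype K]
    (g : O → K → Z) (σ : O → K → Matrix R R ℂ) (μ : O → K → ℝ) : ℝ :=
  quantumCondMutualInfo
    (Matrix.of fun (i j : R × O × (K × Set.range (fun a : O × K => g a.1 a.2))) =>
      if i.2 = j.2 ∧ (i.2.2.2 : Z) = g i.2.1 i.2.2.1 then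
        (μ i.2.1 i.2.2.1 : ℂ) * σ i.2.1 i.2.2.1 i.1 j.1
      else 0)

/-! # Quantum protocols -/

/-- The computational basis states of the qubits `q` with `S q`. -/
abbrev Bits {n : ℕ} (S : Fin n → Prop) : Type := {q : Fin n // S q} → Bool

/-- The joint basis state of all qubits: `a` on the qubits in `S` and `c` on the others. -/
def merge {n : ℕ} (S : Fin n → Prop) [DecidablePred S] (a : Bits S) (c : Bits fun q => ¬ S q) :
    Fin n → Bool :=
  (Equiv.piEquivPiSubtypeProd S fun _ => Bool).symm (a, c)

/-- Apply `U ⊗ 1` to the state vector `ψ`, where `U` acts on the qubits in `S`. -/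
def applyLocal {n : ℕ} (S : Fin n → Prop) [DecidablePred S] (U : Matrix (Bits S) (Bits S) ℂ)
    (ψ : (Fin n → Bool) → ℂ) : (Fin n → Bool) → ℂ :=
  fun c => ∑ a : Bits S, U (fun q => c q) a * ψ (merge S a fun q => c q)

/-- The reduced density matrix of the pure state `ψ` on the qubits in `S`. -/
def reducedState {n : ℕ} (S : Fin n → Prop) [DecidablePred S] (ψ : (Fin n → Bool) → ℂ) :
    Matrix (Bits S) (Bits S) ℂ :=
  Matrix.of fun a b => ∑ c : Bits (fun q => ¬ S q), ψ (merge S a c) * star (ψ (merge S b c))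

/-- A two-party quantum protocol. All qubits start in the state `|0⟩`, and each of them is owned by
one of the players. In round `t` the player `speaker t` applies to the qubits he owns a unitary
transformation that is controlled by his (classical, never erased) input, and then gives some of his
qubits to the other player. After the last round a player may measure his qubits in the
computational basis and read off a result. There is neither a public coin nor prior entanglement.
What the fields say about rounds after the last one is not used. -/
structure QuantumProtocol (X Y Z : Type*) where
  /-- the total number of private and message qubits -/
  qubits : ℕ
  /-- the number of rounds -/
  rounds : ℕ
  /-- the player whose turn it is in round `t` -/
  speaker : ℕ → Player
  /-- the owner of a qubit when `t` rounds have been played -/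
  owner : ℕ → Fin qubits → Player
  /-- only the player whose turn it is can give qubits away -/
  owner_succ : ∀ t q, owner t q ≠ speaker t → owner (t + 1) q = owner t q
  /-- what Al does in round `t`, if it is his turn -/
  opAl : (t : ℕ) → X → Matrix.unitaryGroup (Bits fun q => owner t q = Player.al) ℂ
  /-- what Bob does in round `t`, if it is his turn -/
  opBob : (t : ℕ) → Y → Matrix.unitaryGroup (Bits fun q => owner t q = Player.bob) ℂ
  /-- the result that Al reads off -/
  outAl : X → (Bits fun q => owner rounds q = Player.al) → Z
  /-- the result that Bob reads off -/
  outBob : Y → (Bits fun q => owner rounds q = Player.bob) → Z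

namespace QuantumProtocol

variable {X Y Z : Type*}

/-- The joint state of all qubits on inputs `x, y` when `t` rounds have been played. -/
def state (P : QuantumProtocol X Y Z) (x : X) (y : Y) : ℕ → (Fin P.qubits → Bool) → ℂ
  | 0 => Pi.single (fun _ => false) 1
  | t + 1 =>
    match P.speaker t with
    | Player.al => applyLocal (fun q => P.owner t q = Player.al) (P.opAl t x).1 (state P x y t)
    | Player.bob => applyLocal (fun q => P.owner t q = Player.bob) (P.opBob t y).1 (state P x y t)

/-- The result of player `p` on inputs `x, y`, if the final measurement finds all qubits in the
basis state `c`. -/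
def result (P : QuantumProtocol X Y Z) (p : Player) (x : X) (y : Y) (c : Fin P.qubits → Bool) : Z :=
  match p with
  | Player.al => P.outAl x fun q => c q
  | Player.bob => P.outBob y fun q => c q

open Classical in
/-- The probability that player `p` ends with the result `z` on inputs `x, y`. -/
def resultProb (P : QuantumProtocol X Y Z) (p : Player) (x : X) (y : Y) (z : Z) : ℝ :=
  ∑ c : Fin P.qubits → Bool, if P.result p x y c = z then ‖P.state x y P.rounds c‖ ^ 2 else 0

/-- On all inputs, player `p` ends with the result `f x y` with probability at least `1 - ε`. -/
def Computes (P : QuantumProtocol X Y Z) (p : Player) (f : X → Y → Z) (ε : ℝ) : Prop :=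
  ∀ x y, 1 - ε ≤ P.resultProb p x y (f x y)

variable [Fintype X] [Fintype Y]

/-- The information `L(t, p, μ)` divulged to player `p` when `t` rounds have been played:
`I(A : Y | X, f(X, Y))` for Al and `I(B : X | Y, f(X, Y))` for Bob, where `A` and `B` are the
qubits that the player then owns and the inputs are distributed according to `μ`. -/
def divulged (P : QuantumProtocol X Y Z) (f : X → Y → Z) (t : ℕ) (p : Player)
    (μ : X × Y → ℝ) : ℝ :=
  match p with
  | Player.al =>
    quantumDivulged (fun y x => f x y)
      (fun y x => reducedState (fun q => P.owner t q = Player.al) (P.state x y t))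
      (fun y x => μ (x, y))
  | Player.bob =>
    quantumDivulged f
      (fun x y => reducedState (fun q => P.owner t q = Player.bob) (P.state x y t))
      (fun x y => μ (x, y))

/-- The privacy loss: the supremum of `L(t, p, μ)` over all times, players and distributions on the
inputs. -/
def privacyLoss (P : QuantumProtocol X Y Z) (f : X → Y → Z) : EReal :=
  ⨆ (t : Fin (P.rounds + 1)) (p : Player) (μ : stdSimplex ℝ (X × Y)),
    ((P.divulged f t p μ.1 : ℝ) : EReal)

end QuantumProtocol

/-! # Classical protocols -/

open Classical in
/-- The Shannon entropy (in bits) of the random variable `W` on a finite sample space `Ω` with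
probability function `pr`. -/
def shannonEntropy {Ω α : Type*} [Fintype Ω] (pr : Ω → ℝ) (W : Ω → α) : ℝ :=
  ∑ w ∈ Finset.univ.image W,
    -((∑ ω, if W ω = w then pr ω else 0) * Real.logb 2 (∑ ω, if W ω = w then pr ω else 0))

/-- `I(U : V | W) = H(U, W) + H(V, W) - H(W) - H(U, V, W)` for random variables. -/
def condMutualInfo {Ω α β γ : Type*} [Fintype Ω] (pr : Ω → ℝ) (U : Ω → α) (V : Ω → β)
    (W : Ω → γ) : ℝ :=
  shannonEntropy pr (fun ω => (U ω, W ω)) + shannonEntropy pr (fun ω => (V ω, W ω))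
    - shannonEntropy pr W - shannonEntropy pr (fun ω => (U ω, V ω, W ω))

/-- A two-party classical randomized protocol with private coins. At the start each player draws
the value of his coins from a finite set. In round `t` the player `speaker t` sends a bit string
that is determined by his input, his coins and the messages of the previous rounds. In the end each
player determines a result from his input, his coins and all messages. -/
structure ClassicalProtocol (X Y Z : Type*) where
  /-- the number of values of Al's coins -/
  coinsAl : ℕ
  /-- the number of values of Bob's coins -/
  coinsBob : ℕ
  /-- the distribution of Al's coins -/
  distAl : stdSimplex ℝ (Fin coinsAl)
  /-- the distribution of Bob's coins -/
  distBob : stdSimplex ℝ (Fin coinsBob)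
  /-- the number of rounds -/
  rounds : ℕ
  /-- the player whose turn it is in round `t` -/
  speaker : ℕ → Player
  /-- Al's message in round `t`, if it is his turn -/
  msgAl : ℕ → X → Fin coinsAl → List (List Bool) → List Bool
  /-- Bob's message in round `t`, if it is his turn -/
  msgBob : ℕ → Y → Fin coinsBob → List (List Bool) → List Bool
  /-- Al's result -/
  outAl : X → Fin coinsAl → List (List Bool) → Z
  /-- Bob's result -/
  outBob : Y → Fin coinsBob → List (List Bool) → Z

namespace ClassicalProtocol

variable {X Y Z : Type*}

/-- The players use no randomness: their coins have only one value. -/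
def IsDeterministic (P : ClassicalProtocol X Y Z) : Prop :=
  P.coinsAl = 1 ∧ P.coinsBob = 1

/-- The messages of the first `t` rounds on inputs `x, y` and coin values `r, s`. -/
def transcript (P : ClassicalProtocol X Y Z) (x : X) (y : Y) (r : Fin P.coinsAl)
    (s : Fin P.coinsBob) : ℕ → List (List Bool)
  | 0 => []
  | t + 1 =>
    transcript P x y r s t ++
      [match P.speaker t with
        | Player.al => P.msgAl t x r (transcript P x y r s t)
        | Player.bob => P.msgBob t y s (transcript P x y r s t)]

/-- The result of player `p` on inputs `x, y` and coin values `r, s`. -/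
def result (P : ClassicalProtocol X Y Z) (p : Player) (x : X) (y : Y) (r : Fin P.coinsAl)
    (s : Fin P.coinsBob) : Z :=
  match p with
  | Player.al => P.outAl x r (P.transcript x y r s P.rounds)
  | Player.bob => P.outBob y s (P.transcript x y r s P.rounds)

open Classical in
/-- The probability that player `p` ends with the result `z` on inputs `x, y`. -/
def resultProb (P : ClassicalProtocol X Y Z) (p : Player) (x : X) (y : Y) (z : Z) : ℝ :=
  ∑ r : Fin P.coinsAl, ∑ s : Fin P.coinsBob,
    if P.result p x y r s = z then P.distAl.1 r * P.distBob.1 s else 0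

/-- On all inputs, player `p` ends with the result `f x y` with probability at least `1 - ε`. -/
def Computes (P : ClassicalProtocol X Y Z) (p : Player) (f : X → Y → Z) (ε : ℝ) : Prop :=
  ∀ x y, 1 - ε ≤ P.resultProb p x y (f x y)

variable [Fintype X] [Fintype Y]

/-- The information `L(t, p, μ)` divulged to player `p` when `t` rounds have been played:
`I(A : Y | X, f(X, Y))` for Al and `I(B : X | Y, f(X, Y))` for Bob, where `A` and `B` consist of the
player's coins and the messages so far, and the inputs are distributed according to `μ`. -/
def divulged (P : ClassicalProtocol X Y Z) (f : X → Y → Z) (t : ℕ) (p : Player)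
    (μ : X × Y → ℝ) : ℝ :=
  let pr : (X × Y) × Fin P.coinsAl × Fin P.coinsBob → ℝ :=
    fun ω => μ ω.1 * (P.distAl.1 ω.2.1 * P.distBob.1 ω.2.2)
  match p with
  | Player.al =>
    condMutualInfo pr (fun ω => (ω.2.1, P.transcript ω.1.1 ω.1.2 ω.2.1 ω.2.2 t))
      (fun ω => ω.1.2) (fun ω => (ω.1.1, f ω.1.1 ω.1.2))
  | Player.bob =>
    condMutualInfo pr (fun ω => (ω.2.2, P.transcript ω.1.1 ω.1.2 ω.2.1 ω.2.2 t))
      (fun ω => ω.1.1) (fun ω => (ω.1.2, f ω.1.1 ω.1.2))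

/-- The privacy loss: the supremum of `L(t, p, μ)` over all times, players and distributions on the
inputs. -/
def privacyLoss (P : ClassicalProtocol X Y Z) (f : X → Y → Z) : EReal :=
  ⨆ (t : Fin (P.rounds + 1)) (p : Player) (μ : stdSimplex ℝ (X × Y)),
    ((P.divulged f t p μ.1 : ℝ) : EReal)

end ClassicalProtocol

/-! # Private functions -/

/-- Some quantum protocol with privacy loss `0` computes `f` with error `ε`, and both players learn
the result. -/
def QuantumPrivate {X Y Z : Type*} [Fintype X] [Fintype Y] (f : X → Y → Z) (ε : ℝ) : Prop :=
  ∃ P : QuantumProtocol X Y Z, (∀ p, P.Computes p f ε) ∧ P.privacyLoss f = 0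

/-- Some classical randomized protocol with privacy loss `0` computes `f` with error `ε`, and both
players learn the result. -/
def ClassicalPrivate {X Y Z : Type*} [Fintype X] [Fintype Y] (f : X → Y → Z) (ε : ℝ) : Prop :=
  ∃ P : ClassicalProtocol X Y Z, (∀ p, P.Computes p f ε) ∧ P.privacyLoss f = 0

/-- Some deterministic protocol with privacy loss `0` computes `f` without error, and both players
learn the result. -/
def DeterministicPrivate {X Y Z : Type*} [Fintype X] [Fintype Y] (f : X → Y → Z) : Prop :=
  ∃ P : ClassicalProtocol X Y Z, P.IsDeterministic ∧ (∀ p, P.Computes p f 0) ∧ P.privacyLoss f = 0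

end

/-! Lower bounds. Let two inputs in one column have the same value of `f` and probability `1/2`
each. The information divulged to Bob is then the entropy of the average of his two states minus the
average of their entropies. Entropy is strictly concave, so privacy loss `0` makes the two states
equal (`eq_of_quantumDivulged_nonpos`, `massAt_eq_of_condMutualInfo_nonpos`); likewise for Al and
two inputs in one row.

In the quantum case, equal reduced states of Bob mean that the global pure states differ by a
unitary on Al's qubits. By induction on the time, the state on a forbidden submatrix is `a x *ᵥ b y
*ᵥ φ`, with `a x` on Al's qubits and `b y` on Bob's (`exists_localUnitary_state`). When Al speaks,
his operators also touch the qubits he hands over. For related rows, a unitary on the qubits he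
keeps maps one state to the other; `b y` commutes with everything involved and cancels, so this
relation holds for all columns and can be chained over all rows. At the end the distribution of a
player's result does not depend on the other input. As the error is below `1/2`, neither does `f`
inside the submatrix, and connectedness makes the submatrix monochromatic.

In the classical case, the probability of a transcript is a product of a factor of Al and a factor
of Bob (`transcriptDist_eq_mul`). By induction its distribution is constant on a forbidden
submatrix: a message of Al leaves Bob's factors unchanged, so independence of the column survives,
and privacy with connectedness gives independence of the row.

Protocols. Without forbidden submatrices, the players in turn announce the class of their input
inside the present block. Inputs with the same value in one row or column are never separated, and a
block that stops shrinking is connected, hence monochromatic. This yields an `IsPrivateLabeling`,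
from which both the deterministic and the quantum protocol are built. -/

/-! ### The entropy function and its strict concavity -/

/-- The function `-x log₂ x`. -/
noncomputable def negMulLogTwo (x : ℝ) : ℝ := -(x * Real.logb 2 x)

lemma negMulLogTwo_eq (x : ℝ) : negMulLogTwo x = (Real.log 2)⁻¹ * Real.negMulLog x := by
  unfold negMulLogTwo Real.negMulLog Real.logb
  ring

@[simp] lemma negMulLogTwo_zero : negMulLogTwo 0 = 0 := by simp [negMulLogTwo]

@[simp] lemma negMulLogTwo_one : negMulLogTwo 1 = 0 := by simp [negMulLogTwo]

lemma strictConcaveOn_negMulLogTwo : StrictConcaveOn ℝ (Set.Ici (0 : ℝ)) negMulLogTwo := by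
  have h : (0 : ℝ) < (Real.log 2)⁻¹ := inv_pos.2 (Real.log_pos one_lt_two)
  refine ⟨convex_Ici 0, fun x hx y hy hxy a b ha hb hab => ?_⟩
  have := mul_lt_mul_of_pos_left (Real.strictConcaveOn_negMulLog.2 hx hy hxy ha hb hab) h
  simp only [negMulLogTwo_eq, smul_eq_mul] at *
  linarith

lemma negMulLogTwo_half (x : ℝ) : negMulLogTwo (2⁻¹ * x) = 2⁻¹ * negMulLogTwo x + 2⁻¹ * x := by
  by_cases hx : x = 0
  · simp [hx]
  · unfold negMulLogTwo
    rw [Real.logb_mul (by norm_num) hx, Real.logb_inv, Real.logb_self_eq_one one_lt_two]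
    ring

lemma add_le_negMulLogTwo_average {x y : ℝ} (hx : 0 ≤ x) (hy : 0 ≤ y) :
    2⁻¹ * negMulLogTwo x + 2⁻¹ * negMulLogTwo y ≤ negMulLogTwo (2⁻¹ * x + 2⁻¹ * y) :=
  strictConcaveOn_negMulLogTwo.concaveOn.2 hx hy (by norm_num) (by norm_num) (by norm_num)

lemma eq_of_negMulLogTwo_average_le {x y : ℝ} (hx : 0 ≤ x) (hy : 0 ≤ y)
    (h : negMulLogTwo (2⁻¹ * x + 2⁻¹ * y) ≤ 2⁻¹ * negMulLogTwo x + 2⁻¹ * negMulLogTwo y) :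
    x = y := by
  by_contra hxy
  exact absurd h (not_le.2 (strictConcaveOn_negMulLogTwo.2 hx hy hxy
    (by norm_num : (0 : ℝ) < 2⁻¹) (by norm_num : (0 : ℝ) < 2⁻¹) (by norm_num)))

/-- Two families of nonnegative numbers agree if averaging them does not increase the entropy. -/
lemma eq_of_sum_negMulLogTwo_average_le {ι : Type*} {s : Finset ι} {p q : ι → ℝ}
    (hp : ∀ i ∈ s, 0 ≤ p i) (hq : ∀ i ∈ s, 0 ≤ q i)
    (h : ∑ i ∈ s, negMulLogTwo (2⁻¹ * p i + 2⁻¹ * q i)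
      ≤ ∑ i ∈ s, (2⁻¹ * negMulLogTwo (p i) + 2⁻¹ * negMulLogTwo (q i))) :
    ∀ i ∈ s, p i = q i := by
  intro i hi
  have h' := (Finset.sum_eq_sum_iff_of_le
    (fun i hi => add_le_negMulLogTwo_average (hp i hi) (hq i hi))).1
    (le_antisymm (Finset.sum_le_sum fun i hi =>
      add_le_negMulLogTwo_average (hp i hi) (hq i hi)) h) i hi
  exact eq_of_negMulLogTwo_average_le (hp i hi) (hq i hi) h'.ge

/-! ### Strict concavity of the von Neumann entropy -/

section VonNeumann

open scoped ComplexOrder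

variable {ι R I : Type*} [Fintype ι] [DecidableEq ι] [Fintype R] [DecidableEq R]
  [Fintype I] [DecidableEq I]

lemma Matrix.unitaryGroup_mul_star (U : Matrix.unitaryGroup ι ℂ) : U.1 * star U.1 = 1 := U.2.2

lemma Matrix.unitaryGroup_star_mul (U : Matrix.unitaryGroup ι ℂ) : star U.1 * U.1 = 1 := U.2.1

lemma vonNeumannEntropy_diagonal (d : ι → ℂ) :
    vonNeumannEntropy (Matrix.diagonal d) = ∑ i, negMulLogTwo (d i).re := by
  unfold vonNeumannEntropy
  rw [Matrix.charpoly_diagonal, Polynomial.roots_prod _ _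
    (Finset.prod_ne_zero_iff.2 fun i _ => Polynomial.X_sub_C_ne_zero _)]
  simp [negMulLogTwo]

lemma vonNeumannEntropy_mul_comm (A B : Matrix ι ι ℂ) :
    vonNeumannEntropy (A * B) = vonNeumannEntropy (B * A) := by
  unfold vonNeumannEntropy
  rw [Matrix.charpoly_mul_comm]

lemma vonNeumannEntropy_unitary_conj (U : Matrix.unitaryGroup ι ℂ) (A : Matrix ι ι ℂ) :
    vonNeumannEntropy (U.1 * A * star U.1) = vonNeumannEntropy A := by
  rw [vonNeumannEntropy_mul_comm, ← mul_assoc, Matrix.unitaryGroup_star_mul, one_mul]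

/-- The characteristic polynomial is the product of those of the blocks, so the multisets of
eigenvalues add up. -/
lemma vonNeumannEntropy_blockDiagonal (N : I → Matrix R R ℂ) :
    vonNeumannEntropy (Matrix.blockDiagonal N) = ∑ i, vonNeumannEntropy (N i) := by
  have h : (Matrix.blockDiagonal N).charpoly = ∏ i, (N i).charpoly := by
    have : (Matrix.blockDiagonal N).charmatrix
        = Matrix.blockDiagonal fun i => (N i).charmatrix := by
      ext ⟨r, i⟩ ⟨s, j⟩
      by_cases hij : i = j <;> by_cases hrs : r = s <;>
        simp [Matrix.blockDiagonal_apply, hij, hrs]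
    unfold Matrix.charpoly
    rw [this, Matrix.det_blockDiagonal]
  unfold vonNeumannEntropy
  rw [h, Polynomial.roots_prod _ _
    (Finset.prod_ne_zero_iff.2 fun i _ => (Matrix.charpoly_monic _).ne_zero),
    Multiset.map_bind, Multiset.sum_bind]
  rfl

lemma exists_unitary_diagonal {A : Matrix ι ι ℂ} (hA : A.PosSemidef) :
    ∃ (U : Matrix.unitaryGroup ι ℂ) (d : ι → ℝ), (∀ i, 0 ≤ d i) ∧
      A = U.1 * Matrix.diagonal (fun i => (d i : ℂ)) * star U.1 := by
  refine ⟨hA.1.eigenvectorUnitary, hA.1.eigenvalues, hA.eigenvalues_nonneg, ?_⟩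
  conv_lhs => rw [hA.1.spectral_theorem]
  rw [Unitary.conjStarAlgAut_apply]
  rfl

lemma unitary_conj_diagonal_apply (U : Matrix ι ι ℂ) (d : ι → ℝ) (i k : ι) :
    (U * Matrix.diagonal (fun i => (d i : ℂ)) * star U) i k
      = ∑ j, U i j * d j * star (U k j) := by
  rw [Matrix.mul_apply]
  simp [Matrix.mul_diagonal, Matrix.star_apply]

lemma sum_normSq_row (U : Matrix.unitaryGroup ι ℂ) (i : ι) :
    ∑ j, Complex.normSq (U.1 i j) = 1 := by
  have h := congrFun (congrFun (Matrix.unitaryGroup_mul_star U) i) i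
  rw [Matrix.mul_apply] at h
  simp only [Matrix.star_apply, Matrix.one_apply_eq, Complex.star_def, Complex.mul_conj] at h
  exact_mod_cast h

lemma sum_normSq_col (U : Matrix.unitaryGroup ι ℂ) (j : ι) :
    ∑ i, Complex.normSq (U.1 i j) = 1 := by
  have h := congrFun (congrFun (Matrix.unitaryGroup_star_mul U) j) j
  rw [Matrix.mul_apply] at h
  simp only [Matrix.star_apply, Matrix.one_apply_eq, Complex.star_def,
    ← Complex.normSq_eq_conj_mul_self] at h
  exact_mod_cast h

/-- The diagonal of a Hermitian matrix averages its eigenvalues with the weights `|U i j|²`, which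
form a doubly stochastic matrix. -/
lemma unitary_conj_diagonal_re (U : Matrix ι ι ℂ) (d : ι → ℝ) (i : ι) :
    ((U * Matrix.diagonal (fun i => (d i : ℂ)) * star U) i i).re
      = ∑ j, Complex.normSq (U i j) * d j := by
  rw [unitary_conj_diagonal_apply, Complex.re_sum]
  refine Finset.sum_congr rfl fun j _ => ?_
  rw [mul_right_comm, Complex.star_def, Complex.mul_conj]
  simp [Complex.mul_re]

lemma sum_mul_negMulLogTwo_le (U : Matrix.unitaryGroup ι ℂ) {d : ι → ℝ} (hd : ∀ i, 0 ≤ d i)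
    (i : ι) : ∑ j, Complex.normSq (U.1 i j) * negMulLogTwo (d j)
      ≤ negMulLogTwo (∑ j, Complex.normSq (U.1 i j) * d j) := by
  simpa using strictConcaveOn_negMulLogTwo.concaveOn.le_map_sum (t := Finset.univ)
    (w := fun j => Complex.normSq (U.1 i j)) (p := d)
    (fun j _ => Complex.normSq_nonneg _) (sum_normSq_row U i) (fun j _ => hd j)

/-- As the columns of weights sum to `1`, the entropy spreads into a double sum that can be compared
with Jensen's inequality row by row. -/
lemma vonNeumannEntropy_unitary_conj_diagonal (U : Matrix.unitaryGroup ι ℂ) (d : ι → ℝ) :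
    vonNeumannEntropy (U.1 * Matrix.diagonal (fun i => (d i : ℂ)) * star U.1)
      = ∑ i, ∑ j, Complex.normSq (U.1 i j) * negMulLogTwo (d j) := by
  rw [vonNeumannEntropy_unitary_conj, vonNeumannEntropy_diagonal, Finset.sum_comm]
  refine Finset.sum_congr rfl fun j _ => ?_
  rw [← Finset.sum_mul, sum_normSq_col, one_mul, Complex.ofReal_re]

/-- The entropy is at most the entropy of the diagonal. -/
lemma vonNeumannEntropy_le_sum_diag {A : Matrix ι ι ℂ} (hA : A.PosSemidef) :
    vonNeumannEntropy A ≤ ∑ i, negMulLogTwo (A i i).re := by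
  obtain ⟨U, d, hd, rfl⟩ := exists_unitary_diagonal hA
  rw [vonNeumannEntropy_unitary_conj_diagonal]
  refine Finset.sum_le_sum fun i _ => ?_
  rw [unitary_conj_diagonal_re]
  exact sum_mul_negMulLogTwo_le U hd i

/-- A positive semidefinite matrix whose diagonal has the same entropy is diagonal. -/
lemma eq_diagonal_of_sum_diag_le {A : Matrix ι ι ℂ} (hA : A.PosSemidef)
    (h : ∑ i, negMulLogTwo (A i i).re ≤ vonNeumannEntropy A) :
    A = Matrix.diagonal fun i => ((A i i).re : ℂ) := by
  have h' := le_antisymm (vonNeumannEntropy_le_sum_diag hA) h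
  obtain ⟨U, d, hd, rfl⟩ := exists_unitary_diagonal hA
  simp only [vonNeumannEntropy_unitary_conj_diagonal, unitary_conj_diagonal_re] at h'
  -- Equality of the sums forces equality in Jensen's inequality in every row.
  have key := (Finset.sum_eq_sum_iff_of_le fun i _ => sum_mul_negMulLogTwo_le U hd i).1 h'
  ext i k
  rw [unitary_conj_diagonal_apply, Matrix.diagonal_apply, unitary_conj_diagonal_re]
  set m := ∑ j, Complex.normSq (U.1 i j) * d j with hm
  -- By strictness, all eigenvalues with positive weight in row `i` equal their mean `m`. Row `i` of
  -- the matrix is then `m` times row `i` of `U * star U = 1`.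
  have hconst : ∀ j, U.1 i j ≠ 0 → d j = m := by
    have := (strictConcaveOn_negMulLogTwo.map_sum_eq_iff_of_nonneg (t := Finset.univ)
      (w := fun j => Complex.normSq (U.1 i j)) (p := d)
      (fun j _ => Complex.normSq_nonneg _) (sum_normSq_row U i) (fun j _ => hd j)).1
      (by simpa using (key i (Finset.mem_univ _)).symm)
    intro j hj
    have hall : ∀ k, Complex.normSq (U.1 i k) * d k = Complex.normSq (U.1 i k) * d j := by
      intro k
      by_cases hk : U.1 i k = 0
      · simp [hk]
      · rw [this (Finset.mem_univ k) (by simpa using hk) (Finset.mem_univ j) (by simpa using hj)]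
    rw [hm, Finset.sum_congr rfl fun k _ => hall k, ← Finset.sum_mul, sum_normSq_row, one_mul]
  have : ∑ j, U.1 i j * d j * star (U.1 k j) = m * ∑ j, U.1 i j * star (U.1 k j) := by
    rw [Finset.mul_sum]
    refine Finset.sum_congr rfl fun j _ => ?_
    by_cases hj : U.1 i j = 0
    · simp [hj]
    · rw [hconst j hj]; ring
  rw [this]
  have h1 := congrFun (congrFun (Matrix.unitaryGroup_mul_star U) i) k
  rw [Matrix.mul_apply] at h1
  simp only [Matrix.star_apply] at h1
  rw [h1, Matrix.one_apply]
  by_cases hik : i = k <;> simp [hik]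

/-- Apply `negMulLogTwo_half` to each eigenvalue; the eigenvalues sum to the trace. -/
lemma vonNeumannEntropy_half {A : Matrix ι ι ℂ} (hA : A.PosSemidef) :
    vonNeumannEntropy ((2⁻¹ : ℂ) • A) = 2⁻¹ * vonNeumannEntropy A + 2⁻¹ * A.trace.re := by
  obtain ⟨U, d, hd, rfl⟩ := exists_unitary_diagonal hA
  have h : (2⁻¹ : ℂ) • (U.1 * Matrix.diagonal (fun i => (d i : ℂ)) * star U.1)
      = U.1 * Matrix.diagonal (fun i => ((2⁻¹ * d i : ℝ) : ℂ)) * star U.1 := by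
    rw [← Matrix.smul_mul, ← Matrix.mul_smul]
    congr 2
    ext i j
    simp [Matrix.diagonal_apply]
  rw [h, vonNeumannEntropy_unitary_conj, vonNeumannEntropy_unitary_conj,
    vonNeumannEntropy_diagonal, vonNeumannEntropy_diagonal, Matrix.trace_mul_comm, ← mul_assoc,
    Matrix.unitaryGroup_star_mul, one_mul, Matrix.trace_diagonal]
  simp only [Complex.ofReal_re, negMulLogTwo_half, Complex.re_sum]
  rw [Finset.sum_add_distrib, Finset.mul_sum, Finset.mul_sum]

/-- The von Neumann entropy is strictly concave. -/
lemma eq_of_vonNeumannEntropy_average_le {A B : Matrix ι ι ℂ} (hA : A.PosSemidef)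
    (hB : B.PosSemidef)
    (h : vonNeumannEntropy ((2⁻¹ : ℂ) • A + (2⁻¹ : ℂ) • B)
      ≤ 2⁻¹ * vonNeumannEntropy A + 2⁻¹ * vonNeumannEntropy B) : A = B := by
  have hhalf : (0 : ℂ) ≤ 2⁻¹ := by
    rw [show (2⁻¹ : ℂ) = ((2⁻¹ : ℝ) : ℂ) by simp, Complex.zero_le_real]; norm_num
  -- In an eigenbasis of the average, its entropy is that of the averaged diagonals. This is at
  -- least the average of the entropies of the two diagonals, which is at least the average of the
  -- two entropies. The hypothesis makes both steps equalities: both matrices are diagonal, with the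
  -- same diagonal.
  obtain ⟨U, d, hd, hU⟩ := exists_unitary_diagonal ((hA.smul hhalf).add (hB.smul hhalf))
  set A' := star U.1 * A * U.1 with hA'
  set B' := star U.1 * B * U.1 with hB'
  have pA : A'.PosSemidef := hA.conjTranspose_mul_mul_same U.1
  have pB : B'.PosSemidef := hB.conjTranspose_mul_mul_same U.1
  have back : ∀ C : Matrix ι ι ℂ, C = U.1 * (star U.1 * C * U.1) * star U.1 := by
    intro C
    rw [← mul_assoc, ← mul_assoc, Matrix.unitaryGroup_mul_star, one_mul, mul_assoc,
      Matrix.unitaryGroup_mul_star, mul_one]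
  have sA : vonNeumannEntropy A' = vonNeumannEntropy A := by
    conv_rhs => rw [back A, vonNeumannEntropy_unitary_conj]
  have sB : vonNeumannEntropy B' = vonNeumannEntropy B := by
    conv_rhs => rw [back B, vonNeumannEntropy_unitary_conj]
  have hdiag : (2⁻¹ : ℂ) • A' + (2⁻¹ : ℂ) • B' = Matrix.diagonal fun i => (d i : ℂ) := by
    have : (2⁻¹ : ℂ) • A' + (2⁻¹ : ℂ) • B'
        = star U.1 * ((2⁻¹ : ℂ) • A + (2⁻¹ : ℂ) • B) * U.1 := by
      simp [hA', hB', mul_add, add_mul]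
    rw [this, hU, ← mul_assoc, ← mul_assoc, Matrix.unitaryGroup_star_mul, one_mul, mul_assoc,
      Matrix.unitaryGroup_star_mul, mul_one]
  have hdi : ∀ i, d i = 2⁻¹ * (A' i i).re + 2⁻¹ * (B' i i).re := by
    intro i
    have := congrArg Complex.re (congrFun (congrFun hdiag i) i)
    simpa using this.symm
  rw [hU, vonNeumannEntropy_unitary_conj, vonNeumannEntropy_diagonal, ← sA, ← sB] at h
  simp only [Complex.ofReal_re, hdi] at h
  have nA : ∀ i, 0 ≤ (A' i i).re := fun i => (Complex.le_def.1 pA.diag_nonneg).1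
  have nB : ∀ i, 0 ≤ (B' i i).re := fun i => (Complex.le_def.1 pB.diag_nonneg).1
  have lA := vonNeumannEntropy_le_sum_diag pA
  have lB := vonNeumannEntropy_le_sum_diag pB
  have hc : 2⁻¹ * ∑ i, negMulLogTwo (A' i i).re + 2⁻¹ * ∑ i, negMulLogTwo (B' i i).re
      ≤ ∑ i, negMulLogTwo (2⁻¹ * (A' i i).re + 2⁻¹ * (B' i i).re) := by
    rw [Finset.mul_sum, Finset.mul_sum, ← Finset.sum_add_distrib]
    exact Finset.sum_le_sum fun i _ => add_le_negMulLogTwo_average (nA i) (nB i)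
  have dA := eq_diagonal_of_sum_diag_le pA (by linarith)
  have dB := eq_diagonal_of_sum_diag_le pB (by linarith)
  have heq := eq_of_sum_negMulLogTwo_average_le (s := Finset.univ) (fun i _ => nA i)
    (fun i _ => nB i) (by
      rw [Finset.sum_add_distrib, ← Finset.mul_sum, ← Finset.mul_sum]; linarith)
  rw [back A, back B, ← hA', ← hB', dA, dB]
  simp only [fun i => heq i (Finset.mem_univ i)]

end VonNeumann

/-! ### Zero information forces equal quantum states -/

lemma sum_pair_eq {Q M N : Type*} [Fintype Q] [Zero M] [AddCommMonoid N] {q₁ q₂ : Q}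
    [∀ q, Decidable (q = q₁ ∨ q = q₂)] (hq : q₁ ≠ q₂)
    (v : Q → M) (h : M → N) (h0 : h 0 = 0) :
    ∑ q, h (if q = q₁ ∨ q = q₂ then v q else 0) = h (v q₁) + h (v q₂) := by
  rw [Fintype.sum_eq_add q₁ q₂ hq (fun x hx => by simp [hx.1, hx.2, h0])]
  simp

section CondMutualInfo

open scoped ComplexOrder

variable {P Q C : Type*} [Fintype P] [Fintype Q] [Fintype C]
  [DecidableEq P] [DecidableEq Q] [DecidableEq C]

@[simp] lemma vonNeumannEntropy_zero : vonNeumannEntropy (0 : Matrix P P ℂ) = 0 := by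
  have := vonNeumannEntropy_diagonal (0 : P → ℂ)
  simpa [Matrix.diagonal_zero'] using this

/-- With `Q` and `C` classical, tracing out `Q` adds up blocks, and tracing out `P` leaves a
diagonal matrix of probabilities. -/
lemma quantumCondMutualInfo_blockDiagonal (N : Q × C → Matrix P P ℂ) :
    quantumCondMutualInfo (Matrix.blockDiagonal N)
      = ∑ c, vonNeumannEntropy (∑ q, N (q, c)) + ∑ i, negMulLogTwo (N i).trace.re
        - ∑ c, negMulLogTwo (∑ q, (N (q, c)).trace).re - ∑ i, vonNeumannEntropy (N i) := by
  unfold quantumCondMutualInfo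
  rw [vonNeumannEntropy_blockDiagonal N]
  have h1 : (Matrix.of fun (i j : P × C) =>
      ∑ q : Q, Matrix.blockDiagonal N (i.1, q, i.2) (j.1, q, j.2))
      = Matrix.blockDiagonal fun c => ∑ q, N (q, c) := by
    ext i j
    by_cases h : i.2 = j.2 <;>
      simp [Matrix.blockDiagonal_apply, Matrix.sum_apply, h]
  have h2 : (Matrix.of fun (i j : Q × C) =>
      ∑ p : P, Matrix.blockDiagonal N (p, i.1, i.2) (p, j.1, j.2))
      = Matrix.diagonal fun i => (N i).trace := by
    ext i j
    by_cases h : i = j <;>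
      simp [Matrix.blockDiagonal_apply, Matrix.trace, h]
  have h3 : (Matrix.of fun (i j : C) =>
      ∑ p : P, ∑ q : Q, Matrix.blockDiagonal N (p, q, i) (p, q, j))
      = Matrix.diagonal fun c => ∑ q, (N (q, c)).trace := by
    ext i j
    by_cases h : i = j
    · simp [Matrix.blockDiagonal_apply, Matrix.trace, h]
      exact Finset.sum_comm
    · simp [Matrix.blockDiagonal_apply, h]
  rw [h1, h2, h3, vonNeumannEntropy_blockDiagonal, vonNeumannEntropy_diagonal,
    vonNeumannEntropy_diagonal]

/-- For a fixed value of `C` the information is the Holevo quantity of the unnormalized ensemble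
`w`. -/
lemma quantumCondMutualInfo_blockDiagonal_single (w : Q → Matrix P P ℂ) (c₀ : C) :
    quantumCondMutualInfo (Matrix.blockDiagonal fun i : Q × C => if i.2 = c₀ then w i.1 else 0)
      = vonNeumannEntropy (∑ q, w q) + ∑ q, negMulLogTwo (w q).trace.re
        - negMulLogTwo (∑ q, (w q).trace).re - ∑ q, vonNeumannEntropy (w q) := by
  rw [quantumCondMutualInfo_blockDiagonal, Fintype.sum_prod_type, Fintype.sum_prod_type,
    Finset.sum_eq_single c₀ (fun c _ hc => by simp [hc]) (by simp),
    Finset.sum_eq_single c₀ (fun c _ hc => by simp [hc]) (by simp)]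
  congr 1
  · congr 2
    · simp
    · refine Finset.sum_congr rfl fun q _ => ?_
      rw [Finset.sum_eq_single c₀ (fun c _ hc => by simp [hc]) (by simp)]
      simp
    · simp
  · refine Finset.sum_congr rfl fun q _ => ?_
    rw [Finset.sum_eq_single c₀ (fun c _ hc => by simp [hc]) (by simp)]
    simp

open Classical in
/-- If no information is divulged when the own input is `k` and the other one is `o₁` or `o₂` with
equal probabilities, then the two states of the register are the same. -/
lemma eq_of_quantumDivulged_nonpos {R O K Z : Type*} [Fintype R] [Fintype O] [Fintype K]
    {g : O → K → Z} {σ : O → K → Matrix R R ℂ} (hσ : ∀ o k, (σ o k).PosSemidef)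
    (htr : ∀ o k, (σ o k).trace = 1) {o₁ o₂ : O} {k₀ : K} (hg : g o₁ k₀ = g o₂ k₀)
    (ho : o₁ ≠ o₂)
    (h : quantumDivulged g σ (fun o k => if k = k₀ ∧ (o = o₁ ∨ o = o₂) then 2⁻¹ else 0) ≤ 0) :
    σ o₁ k₀ = σ o₂ k₀ := by
  -- Both inputs lead to the same conditioning value `c₀`, so only the blocks over `c₀` are nonzero.
  set c₀ : K × Set.range (fun a : O × K => g a.1 a.2) := (k₀, ⟨g o₁ k₀, (o₁, k₀), rfl⟩) with hc₀
  have hm : (Matrix.of fun (i j : R × O × (K × Set.range (fun a : O × K => g a.1 a.2))) =>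
      if i.2 = j.2 ∧ (i.2.2.2 : Z) = g i.2.1 i.2.2.1 then
        ((if i.2.2.1 = k₀ ∧ (i.2.1 = o₁ ∨ i.2.1 = o₂) then 2⁻¹ else 0 : ℝ) : ℂ)
          * σ i.2.1 i.2.2.1 i.1 j.1
      else 0) = Matrix.blockDiagonal
        fun i : O × (K × Set.range (fun a : O × K => g a.1 a.2)) =>
          if i.2 = c₀ then (if i.1 = o₁ ∨ i.1 = o₂ then (2⁻¹ : ℂ) • σ i.1 k₀ else 0) else 0 := by
    ext ⟨r, i⟩ ⟨s, j⟩
    rw [Matrix.of_apply, Matrix.blockDiagonal_apply]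
    by_cases hij : i = j
    · subst hij
      obtain ⟨o, k, z⟩ := i
      by_cases hoo : o = o₁ ∨ o = o₂
      · by_cases hk : k = k₀
        · subst hk
          have hgo : g o k = g o₁ k := by rcases hoo with rfl | rfl <;> simp [hg]
          have : (z : Z) = g o k ↔ (k, z) = c₀ := by
            simp [hc₀, Prod.ext_iff, Subtype.ext_iff, hgo]
          by_cases hz : (k, z) = c₀
          · simp [hoo, hz, this.2 hz]
          · simp [hz, mt this.1 hz]
        · have : (k, z) ≠ c₀ := fun h => hk (congrArg Prod.fst h)
          simp [hk, this]
      · simp [hoo]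
    · simp [hij]
  unfold quantumDivulged at h
  rw [hm] at h
  replace h := le_of_eq_of_le (quantumCondMutualInfo_blockDiagonal_single
    (fun o => if o = o₁ ∨ o = o₂ then (2⁻¹ : ℂ) • σ o k₀ else 0) c₀).symm (by convert h)
  have hsum := sum_pair_eq ho (fun o => (2⁻¹ : ℂ) • σ o k₀) id rfl
  simp only [id] at hsum
  rw [hsum, sum_pair_eq ho _ vonNeumannEntropy vonNeumannEntropy_zero,
    sum_pair_eq ho _ Matrix.trace (by simp),
    sum_pair_eq ho _ (fun w : Matrix R R ℂ => negMulLogTwo w.trace.re) (by simp),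
    vonNeumannEntropy_half (hσ _ _), vonNeumannEntropy_half (hσ _ _)] at h
  have hhalf : negMulLogTwo (2⁻¹ : ℝ) = 2⁻¹ := by simpa using negMulLogTwo_half 1
  have h2 : (2⁻¹ + 2⁻¹ : ℝ) = 1 := by norm_num
  simp only [Matrix.trace_smul, htr, Complex.add_re, smul_eq_mul, mul_one, Complex.one_re,
    show (2⁻¹ : ℂ).re = 2⁻¹ by norm_num, hhalf, h2, negMulLogTwo_one] at h
  -- The fair choice of the input contributes one bit to `S(QC)`; the two factors `1/2` contribute
  -- the same bit to `S(PQC)`, and it cancels.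
  exact eq_of_vonNeumannEntropy_average_le (hσ _ _) (hσ _ _) (by linarith)

end CondMutualInfo

/-! ### Operators on some of the qubits, and uniqueness of purifications -/

section LocalOperators

open Matrix Kronecker

/-- If `A Aᴴ = B Bᴴ`, then `A` and `B` differ by a unitary factor on the right. -/
lemma exists_unitary_of_mul_conjTranspose_eq {m n : Type*} [Fintype m] [Fintype n] [DecidableEq m]
    [DecidableEq n] {A B : Matrix m n ℂ} (h : A * Aᴴ = B * Bᴴ) :
    ∃ U ∈ unitaryGroup n ℂ, B = A * U := by
  set f := toEuclideanLin Aᴴ with hf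
  set g := toEuclideanLin Bᴴ with hg
  -- Thus `Aᴴ v ↦ Bᴴ v` is a well-defined isometry on the range of `Aᴴ`; in finite dimension it
  -- extends to a unitary of the whole space.
  have hnorm : ∀ v, ‖f v‖ = ‖g v‖ := by
    have key : ∀ (C : Matrix m n ℂ) v, ((‖toEuclideanLin Cᴴ v‖ ^ 2 : ℝ) : ℂ)
        = star v.ofLp ⬝ᵥ (C * Cᴴ) *ᵥ v.ofLp := by
      intro C v
      have hs : star (Cᴴ *ᵥ v.ofLp) = star v.ofLp ᵥ* C := by
        rw [star_mulVec, conjTranspose_conjTranspose]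
      rw [← mulVec_mulVec, dotProduct_mulVec, ← hs]
      have := inner_self_eq_norm_sq_to_K (𝕜 := ℂ) (toEuclideanLin Cᴴ v)
      rw [EuclideanSpace.inner_eq_star_dotProduct, dotProduct_comm] at this
      simpa using this.symm
    intro v
    have : ((‖f v‖ ^ 2 : ℝ) : ℂ) = ((‖g v‖ ^ 2 : ℝ) : ℂ) := by rw [key, key, h]
    exact (sq_eq_sq₀ (norm_nonneg _) (norm_nonneg _)).1 (by exact_mod_cast this)
  -- A linear section of `f` on its range; `g ∘ₗ r` is the isometry, and `hnorm` makes it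
  -- independent of the section.
  obtain ⟨r, hr⟩ := f.rangeRestrict.exists_rightInverse_of_surjective
    (LinearMap.range_rangeRestrict f)
  have hr' : ∀ u, f (r u) = u := fun u => congrArg Subtype.val (LinearMap.congr_fun hr u)
  let L : LinearMap.range f →ₗᵢ[ℂ] EuclideanSpace ℂ n :=
    ⟨g ∘ₗ r, fun u => by rw [LinearMap.comp_apply, ← hnorm, hr']; rfl⟩
  have hL : ∀ v, L.extend (f v) = g v := by
    intro v
    have h1 := L.extend_apply ⟨f v, v, rfl⟩
    rw [h1]
    change g (r _) = g v
    rw [← sub_eq_zero, ← map_sub, ← norm_eq_zero, ← hnorm, map_sub, hr']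
    simp
  let V : Matrix n n ℂ := toEuclideanLin.symm L.extend.toLinearMap
  have hV : ∀ v, toEuclideanLin V v = L.extend v := fun v => by simp [V]
  have hBA : Bᴴ = V * Aᴴ := by
    apply toEuclideanLin.injective
    ext1 v
    rw [toLpLin_mul_same]
    exact (hL v).symm.trans (hV _).symm
  have hVu : Vᴴ * V = 1 := by
    apply toEuclideanLin.injective
    ext1 v
    refine ext_inner_left ℂ fun w => ?_
    rw [toLpLin_mul_same, toEuclideanLin_conjTranspose_eq_adjoint, LinearMap.comp_apply,
      LinearMap.adjoint_inner_right, hV, hV, L.extend.inner_map_map]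
    simp
  refine ⟨Vᴴ, ?_, ?_⟩
  · rw [mem_unitaryGroup_iff, star_eq_conjTranspose, conjTranspose_conjTranspose]
    exact hVu
  · rw [← conjTranspose_conjTranspose B, hBA, conjTranspose_mul, conjTranspose_conjTranspose]

variable {n : ℕ} {S T : Fin n → Prop} {W V : Matrix (Fin n → Bool) (Fin n → Bool) ℂ}

/-- `W` acts on the qubits in `S` only. -/
def LocalOn (S : Fin n → Prop) (W : Matrix (Fin n → Bool) (Fin n → Bool) ℂ) : Prop :=
  (∀ c d, (∃ q, ¬ S q ∧ c q ≠ d q) → W c d = 0) ∧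
  ∀ c d c' d', (∀ q, ¬ S q → c q = d q) → (∀ q, ¬ S q → c' q = d' q) →
    (∀ q, S q → c q = c' q ∧ d q = d' q) → W c d = W c' d'

/-- Ownership changes from round to round. Locality is therefore a property of matrices on all
qubits, which passes to larger sets without a change of type. -/
lemma LocalOn.mono (h : LocalOn S W) (hST : ∀ q, S q → T q) : LocalOn T W := by
  refine ⟨fun c d ⟨q, hq, hcd⟩ => h.1 c d ⟨q, fun hS => hq (hST q hS), hcd⟩,
    fun c d c' d' h1 h2 h3 => ?_⟩
  by_cases hcd : ∃ q, ¬ S q ∧ c q ≠ d q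
  · rw [h.1 c d hcd, h.1 c' d']
    obtain ⟨q, hq, hne⟩ := hcd
    have hT : T q := by
      by_contra hT
      exact hne (h1 q hT)
    exact ⟨q, hq, by rwa [← (h3 q hT).1, ← (h3 q hT).2]⟩
  · push Not at hcd
    refine h.2 c d c' d' hcd (fun q hq => ?_) fun q hq => h3 q (hST q hq)
    by_cases hT : T q
    · rw [← (h3 q hT).1, ← (h3 q hT).2, hcd q hq]
    · exact h2 q hT

-- Only one intermediate basis state contributes to an entry of `W * V`: it agrees with `d` on `S`
-- and with `c` elsewhere. Both products thus reduce to a single term each.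
open Classical in
lemma LocalOn.commute (hW : LocalOn S W) (hV : LocalOn T V) (hST : ∀ q, S q → ¬ T q) :
    W * V = V * W := by
  have aux : ∀ {S T : Fin n → Prop} {W V : Matrix (Fin n → Bool) (Fin n → Bool) ℂ},
      LocalOn S W → LocalOn T V → (∀ q, S q → ¬ T q) → ∀ c d, (W * V) c d
        = W c (fun q => if S q then d q else c q) * V (fun q => if S q then d q else c q) d := by
    intro S T W V hW hV hST c d
    rw [mul_apply]
    refine Finset.sum_eq_single _ (fun e _ he => ?_) (by simp)
    obtain ⟨q, hq⟩ := Function.ne_iff.1 he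
    by_cases hS : S q
    · rw [hV.1 e d ⟨q, hST q hS, by simpa [hS] using hq⟩, mul_zero]
    · rw [hW.1 c e ⟨q, hS, by simpa [hS, eq_comm] using hq⟩, zero_mul]
  ext c d
  rw [aux hW hV hST, aux hV hW fun q hT hS => hST q hS hT]
  by_cases hcd : ∃ q, ¬ S q ∧ ¬ T q ∧ c q ≠ d q
  · obtain ⟨q, hS, hT, hne⟩ := hcd
    rw [hV.1 _ d ⟨q, hT, by simpa [hS] using hne⟩, hW.1 _ d ⟨q, hS, by simpa [hT] using hne⟩]
    simp
  · push Not at hcd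
    rw [mul_comm (V _ _)]
    congr 1
    · refine hW.2 _ _ _ _ (fun q hq => by simp [hq]) (fun q hq => ?_) fun q hq => ?_
      · by_cases hT : T q <;> simp [hT, hcd q hq]
      · simp [hq, hST q hq]
    · refine hV.2 _ _ _ _ (fun q hq => ?_) (fun q hq => by simp [hq]) fun q hq => ?_
      · by_cases hS : S q
        · simp [hS]
        · simp [hS, hcd q hS hq]
      · simp [hq, show ¬ S q from fun hS => hST q hS hq]

/-- The matrix of `U ⊗ 1`, where `U` acts on the qubits in `S`. -/
def embedLocal (S : Fin n → Prop) [DecidablePred S] (U : Matrix (Bits S) (Bits S) ℂ) :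
    Matrix (Fin n → Bool) (Fin n → Bool) ℂ :=
  (U ⊗ₖ (1 : Matrix (Bits fun q => ¬ S q) (Bits fun q => ¬ S q) ℂ)).submatrix
    (Equiv.piEquivPiSubtypeProd S fun _ => Bool) (Equiv.piEquivPiSubtypeProd S fun _ => Bool)

lemma embedLocal_apply [DecidablePred S] (U : Matrix (Bits S) (Bits S) ℂ) (c d : Fin n → Bool) :
    embedLocal S U c d = if ∀ q, ¬ S q → c q = d q then U (fun q => c q) (fun q => d q) else 0 := by
  have : ((fun q : {q // ¬ S q} => c q) = fun q : {q // ¬ S q} => d q) ↔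
      ∀ q, ¬ S q → c q = d q := by
    rw [funext_iff, Subtype.forall]
  by_cases h : ∀ q, ¬ S q → c q = d q
  · rw [if_pos h]
    simp [embedLocal, Equiv.piEquivPiSubtypeProd, one_apply, this.2 h]
  · rw [if_neg h]
    simp [embedLocal, Equiv.piEquivPiSubtypeProd, one_apply, mt this.1 h]

lemma localOn_embedLocal [DecidablePred S] (U : Matrix (Bits S) (Bits S) ℂ) :
    LocalOn S (embedLocal S U) := by
  refine ⟨fun c d ⟨q, hq, hne⟩ => ?_, fun c d c' d' h1 h2 h3 => ?_⟩
  · rw [embedLocal_apply, if_neg fun h => hne (h q hq)]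
  · rw [embedLocal_apply, embedLocal_apply, if_pos h1, if_pos h2]
    congr 1
    · exact funext fun q => (h3 q q.2).1
    · exact funext fun q => (h3 q q.2).2

lemma merge_of_mem [DecidablePred S] (a : Bits S) (c : Bits fun q => ¬ S q) {q : Fin n}
    (hq : S q) : merge S a c q = a ⟨q, hq⟩ := by
  simp [merge, Equiv.piEquivPiSubtypeProd, hq]

lemma merge_of_not_mem [DecidablePred S] (a : Bits S) (c : Bits fun q => ¬ S q) {q : Fin n}
    (hq : ¬ S q) : merge S a c q = c ⟨q, hq⟩ := by
  simp [merge, Equiv.piEquivPiSubtypeProd, hq]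

lemma LocalOn.exists_eq_embedLocal [DecidablePred S] (h : LocalOn S W) :
    ∃ U, W = embedLocal S U := by
  -- The entry does not depend on the common value of the other qubits, so `false` is as good as
  -- any.
  refine ⟨of fun a b => W (merge S a fun _ => false) (merge S b fun _ => false), ?_⟩
  ext c d
  rw [embedLocal_apply]
  split_ifs with hcd
  · refine h.2 _ _ _ _ hcd (fun q hq => ?_) fun q hq => ?_
    · rw [merge_of_not_mem _ _ hq, merge_of_not_mem _ _ hq]
    · rw [merge_of_mem _ _ hq, merge_of_mem _ _ hq]
      exact ⟨rfl, rfl⟩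
  · push Not at hcd
    exact h.1 c d hcd

lemma embedLocal_mul [DecidablePred S] (U U' : Matrix (Bits S) (Bits S) ℂ) :
    embedLocal S U * embedLocal S U' = embedLocal S (U * U') := by
  unfold embedLocal
  rw [submatrix_mul_equiv, ← mul_kronecker_mul, one_mul]

lemma embedLocal_one [DecidablePred S] : embedLocal S 1 = 1 := by
  unfold embedLocal
  rw [one_kronecker_one, submatrix_one_equiv]

lemma star_embedLocal [DecidablePred S] (U : Matrix (Bits S) (Bits S) ℂ) :
    star (embedLocal S U) = embedLocal S (star U) := by
  unfold embedLocal
  rw [star_eq_conjTranspose, conjTranspose_submatrix, conjTranspose_kronecker, conjTranspose_one]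
  rfl

open Classical in
lemma LocalOn.mul (hW : LocalOn S W) (hV : LocalOn S V) : LocalOn S (W * V) := by
  obtain ⟨U, rfl⟩ := hW.exists_eq_embedLocal
  obtain ⟨U', rfl⟩ := hV.exists_eq_embedLocal
  rw [embedLocal_mul]
  exact localOn_embedLocal _

lemma restrict_merge [DecidablePred S] (a : Bits S) (c : Bits fun q => ¬ S q) :
    (fun q : {q // S q} => merge S a c q) = a :=
  funext fun q => merge_of_mem a c q.2

lemma embedLocal_mulVec [DecidablePred S] (U : Matrix (Bits S) (Bits S) ℂ)
    (ψ : (Fin n → Bool) → ℂ) : embedLocal S U *ᵥ ψ = applyLocal S U ψ := by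
  ext c
  rw [mulVec, dotProduct, applyLocal,
    ← (Equiv.piEquivPiSubtypeProd S fun _ => Bool).symm.sum_comp, Fintype.sum_prod_type]
  refine Finset.sum_congr rfl fun a _ => ?_
  change ∑ y : {q // ¬ S q} → Bool, embedLocal S U c (merge S a y) * ψ (merge S a y) = _
  rw [Finset.sum_eq_single fun q : {q // ¬ S q} => c q]
  · rw [embedLocal_apply, restrict_merge, if_pos]
    intro q hq
    rw [merge_of_not_mem _ _ hq]
  · intro d _ hd
    rw [embedLocal_apply, if_neg, zero_mul]
    intro h
    exact hd (funext fun q => by rw [h q q.2, merge_of_not_mem _ _ q.2])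
  · simp

/-- The unitary matrices that act on the qubits in `S` only. -/
def localUnitary (S : Fin n → Prop) : Submonoid (Matrix (Fin n → Bool) (Fin n → Bool) ℂ) where
  carrier := {W | W ∈ unitaryGroup (Fin n → Bool) ℂ ∧ LocalOn S W}
  mul_mem' h h' := ⟨mul_mem h.1 h'.1, h.2.mul h'.2⟩
  one_mem' := ⟨one_mem _, by
    classical
    rw [← embedLocal_one (S := S)]
    exact localOn_embedLocal _⟩

lemma localUnitary_mono (hST : ∀ q, S q → T q) (hW : W ∈ localUnitary S) : W ∈ localUnitary T :=
  ⟨hW.1, hW.2.mono hST⟩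

lemma star_mul_of_mem_localUnitary (hW : W ∈ localUnitary S) : star W * W = 1 := hW.1.1

lemma embedLocal_mem_localUnitary [DecidablePred S] (U : unitaryGroup (Bits S) ℂ) :
    embedLocal S U.1 ∈ localUnitary S := by
  refine ⟨?_, localOn_embedLocal _⟩
  rw [mem_unitaryGroup_iff, star_embedLocal, embedLocal_mul, unitaryGroup_mul_star, embedLocal_one]

lemma reducedState_eq_mul_conjTranspose [DecidablePred S] (ψ : (Fin n → Bool) → ℂ) :
    reducedState S ψ = (of fun a c => ψ (merge S a c)) * (of fun a c => ψ (merge S a c))ᴴ := by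
  ext a b
  simp [reducedState, mul_apply]

/-- Two pure states with the same reduced state on `S` differ by a unitary transformation of the
other qubits. -/
lemma exists_localUnitary_of_reducedState_eq [DecidablePred S] {ψ φ : (Fin n → Bool) → ℂ}
    (h : reducedState S ψ = reducedState S φ) :
    ∃ W ∈ localUnitary fun q => ¬ S q, φ = W *ᵥ ψ := by
  rw [reducedState_eq_mul_conjTranspose, reducedState_eq_mul_conjTranspose] at h
  obtain ⟨U, hU, hφ⟩ := exists_unitary_of_mul_conjTranspose_eq h
  set e := Equiv.piEquivPiSubtypeProd S fun _ => Bool with he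
  -- `U` multiplies the column index from the right; as an operator on state vectors it becomes
  -- `Uᵀ`.
  refine ⟨((1 : Matrix (Bits S) (Bits S) ℂ) ⊗ₖ Uᵀ).submatrix e e, ⟨?_, ?_, ?_⟩, ?_⟩
  · have hU' : Uᵀ * (Uᵀ)ᴴ = 1 := by
      rw [show (Uᵀ)ᴴ = (Uᴴ)ᵀ from rfl, ← transpose_mul, ← star_eq_conjTranspose, hU.1,
        transpose_one]
    rw [mem_unitaryGroup_iff, star_eq_conjTranspose, conjTranspose_submatrix,
      conjTranspose_kronecker, submatrix_mul_equiv, ← mul_kronecker_mul, conjTranspose_one, one_mul,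
      hU', one_kronecker_one, submatrix_one_equiv]
  · rintro c d ⟨q, hq, hne⟩
    have : (fun q : {q // S q} => c q) ≠ fun q : {q // S q} => d q :=
      fun h => hne (congrFun h ⟨q, not_not.1 hq⟩)
    simp [he, Equiv.piEquivPiSubtypeProd, one_apply, this]
  · intro c d c' d' h1 h2 h3
    have e1 : (fun q : {q // S q} => c q) = fun q : {q // S q} => d q :=
      funext fun q : {q // S q} => h1 q (not_not.2 q.2)
    have e2 : (fun q : {q // S q} => c' q) = fun q : {q // S q} => d' q :=
      funext fun q : {q // S q} => h2 q (not_not.2 q.2)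
    have e3 : (fun q : {q // ¬ S q} => c q) = fun q : {q // ¬ S q} => c' q :=
      funext fun q : {q // ¬ S q} => (h3 q q.2).1
    have e4 : (fun q : {q // ¬ S q} => d q) = fun q : {q // ¬ S q} => d' q :=
      funext fun q : {q // ¬ S q} => (h3 q q.2).2
    simp [he, Equiv.piEquivPiSubtypeProd, one_apply, e1, e2, e3, e4]
  · ext c
    obtain ⟨⟨a, b⟩, rfl⟩ := e.symm.surjective c
    have := congrFun (congrFun hφ a) b
    rw [mul_apply] at this
    rw [mulVec, dotProduct, ← e.symm.sum_comp, Fintype.sum_prod_type,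
      Finset.sum_eq_single a (fun a' _ ha => by simp [one_apply, ha.symm]) (by simp)]
    simp only [of_apply] at this
    change φ (merge S a b) = _
    rw [this]
    refine Finset.sum_congr rfl fun b' _ => ?_
    simp [merge, mul_comm, he]

lemma sum_normSq_mulVec (hW : W ∈ unitaryGroup (Fin n → Bool) ℂ) (ψ : (Fin n → Bool) → ℂ) :
    ∑ c, ‖(W *ᵥ ψ) c‖ ^ 2 = ∑ c, ‖ψ c‖ ^ 2 := by
  have key : ∀ v : (Fin n → Bool) → ℂ, ((∑ c, ‖v c‖ ^ 2 : ℝ) : ℂ) = star v ⬝ᵥ v := by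
    intro v
    simp [dotProduct, Complex.conj_mul']
  have : ((∑ c, ‖(W *ᵥ ψ) c‖ ^ 2 : ℝ) : ℂ) = ((∑ c, ‖ψ c‖ ^ 2 : ℝ) : ℂ) := by
    rw [key, key, star_mulVec, ← dotProduct_mulVec, mulVec_mulVec, ← star_eq_conjTranspose, hW.1,
      one_mulVec]
  exact_mod_cast this

/-- A unitary transformation of some qubits does not change the outcome probabilities of the
others. -/
lemma sum_ite_normSq_mulVec (hW : W ∈ localUnitary T) (hST : ∀ q, S q → ¬ T q)
    (ψ : (Fin n → Bool) → ℂ) (g : (Fin n → Bool) → Prop) [DecidablePred g]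
    (hg : ∀ c c', (∀ q, S q → c q = c' q) → (g c ↔ g c')) :
    ∑ c, (if g c then ‖(W *ᵥ ψ) c‖ ^ 2 else 0) = ∑ c, if g c then ‖ψ c‖ ^ 2 else 0 := by
  -- The projection onto the event: the probability is the squared norm of `D *ᵥ ψ`, and `D` is
  -- local on `S`, hence commutes with `W`.
  set D : Matrix (Fin n → Bool) (Fin n → Bool) ℂ := diagonal fun c => if g c then 1 else 0 with hD
  have hloc : LocalOn S D := by
    refine ⟨fun c d ⟨q, _, hne⟩ => ?_, fun c d c' d' h1 h2 h3 => ?_⟩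
    · rw [hD, diagonal_apply_ne]
      exact fun h => hne (congrFun h q)
    · have hcd : c = d ↔ c' = d' := by
        simp only [funext_iff]
        refine forall_congr' fun q => ?_
        by_cases hq : S q
        · rw [(h3 q hq).1, (h3 q hq).2]
        · exact iff_of_true (h1 q hq) (h2 q hq)
      simp only [hD, diagonal_apply, hcd, hg c c' fun q hq => (h3 q hq).1]
  have hnorm : ∀ v : (Fin n → Bool) → ℂ,
      ∑ c, (if g c then ‖v c‖ ^ 2 else 0) = ∑ c, ‖(D *ᵥ v) c‖ ^ 2 := by
    intro v
    refine Finset.sum_congr rfl fun c _ => ?_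
    rw [hD, mulVec_diagonal]
    split_ifs <;> simp
  rw [hnorm, hnorm, mulVec_mulVec, hloc.commute hW.2 hST, ← mulVec_mulVec, sum_normSq_mulVec hW.1]

end LocalOperators

/-! ### Forbidden submatrices exclude private quantum protocols -/

section QuantumLowerBound

open Matrix

open scoped ComplexOrder

lemma posSemidef_reducedState {n : ℕ} (S : Fin n → Prop) [DecidablePred S]
    (ψ : (Fin n → Bool) → ℂ) : (reducedState S ψ).PosSemidef := by
  rw [reducedState_eq_mul_conjTranspose]
  exact posSemidef_self_mul_conjTranspose _

lemma trace_reducedState {n : ℕ} (S : Fin n → Prop) [DecidablePred S]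
    (ψ : (Fin n → Bool) → ℂ) : (reducedState S ψ).trace = ((∑ c, ‖ψ c‖ ^ 2 : ℝ) : ℂ) := by
  rw [← (Equiv.piEquivPiSubtypeProd S fun _ => Bool).symm.sum_comp, Fintype.sum_prod_type]
  simp [trace, reducedState, merge, Complex.mul_conj']

open Classical in
lemma pair_mem_stdSimplex {Q : Type*} [Fintype Q] {a b : Q} (h : a ≠ b) :
    (fun q => if q = a ∨ q = b then (2⁻¹ : ℝ) else 0) ∈ stdSimplex ℝ Q := by
  refine ⟨fun q => ?_, ?_⟩
  · dsimp only
    split_ifs <;> norm_num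
  · have := sum_pair_eq h (fun _ => (2⁻¹ : ℝ)) id rfl
    simp only [id] at this
    rw [this]
    norm_num

variable {X Y Z : Type*}

/-- If transformations `a x` of the qubits in `S` and `b y` of the others act on a state `φ`, and
the reduced states outside of `S' ⊆ S` agree for related `x`, then the `a x` can be
replaced by transformations of the qubits in `S'`. -/
lemma exists_localUnitary_of_transGen {n : ℕ} {S S' T : Fin n → Prop} [DecidablePred T]
    (hS : ∀ q, S' q → S q) (hT : ∀ q, ¬ T q → S' q)
    {a : X → Matrix (Fin n → Bool) (Fin n → Bool) ℂ}
    {b : Y → Matrix (Fin n → Bool) (Fin n → Bool) ℂ} {φ : (Fin n → Bool) → ℂ}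
    (ha : ∀ x, a x ∈ localUnitary S) (hb : ∀ y, b y ∈ localUnitary fun q => ¬ S q)
    {r : X → X → Prop}
    (hr : ∀ x x', r x x' → ∃ y, reducedState T (a x *ᵥ b y *ᵥ φ)
      = reducedState T (a x' *ᵥ b y *ᵥ φ))
    (hall : ∀ x x', Relation.TransGen r x x') (x₀ : X) :
    ∃ w : X → Matrix (Fin n → Bool) (Fin n → Bool) ℂ, (∀ x, w x ∈ localUnitary S') ∧
      ∀ x, a x *ᵥ φ = w x *ᵥ a x₀ *ᵥ φ := by
  have hcomm : ∀ {x y}, a x * b y = b y * a x := fun {x y} =>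
    (ha x).2.commute (hb y).2 fun q hq => not_not.2 hq
  have step : ∀ x x', r x x' → ∃ W ∈ localUnitary S', a x' *ᵥ φ = W *ᵥ a x *ᵥ φ := by
    intro x x' h
    obtain ⟨y, hy⟩ := hr x x' h
    obtain ⟨W, hW, hWφ⟩ := exists_localUnitary_of_reducedState_eq hy
    replace hW : W ∈ localUnitary S' := localUnitary_mono hT hW
    have hWb : W * b y = b y * W :=
      hW.2.commute (hb y).2 fun q hq => not_not.2 (hS q hq)
    refine ⟨W, hW, ?_⟩
    -- `b y` commutes with `a x`, `a x'` and `W`, so it can be moved to the front and cancelled.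
    -- What remains does not mention the column.
    have := congrArg (star (b y) *ᵥ ·) hWφ
    simp only [mulVec_mulVec] at this ⊢
    rw [hcomm, ← mul_assoc (star (b y)), star_mul_of_mem_localUnitary (hb y), one_mul, hcomm,
      ← mul_assoc W, hWb, mul_assoc (b y), ← mul_assoc (star (b y)),
      star_mul_of_mem_localUnitary (hb y), one_mul] at this
    exact this
  have trans : ∀ x, ∃ W ∈ localUnitary S', a x *ᵥ φ = W *ᵥ a x₀ *ᵥ φ := by
    intro x
    induction hall x₀ x with
    | single h => exact step _ _ h
    | tail _ h ih =>
      obtain ⟨W, hW, h1⟩ := ih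
      obtain ⟨W', hW', h2⟩ := step _ _ h
      exact ⟨W' * W, mul_mem hW' hW, by rw [h2, h1, mulVec_mulVec, mulVec_mulVec]⟩
  choose w hw using trans
  exact ⟨w, fun x => (hw x).1, fun x => (hw x).2⟩

namespace QuantumProtocol

variable (P : QuantumProtocol X Y Z)

lemma owner_ne_al (t : ℕ) (q : Fin P.qubits) :
    P.owner t q ≠ Player.al ↔ P.owner t q = Player.bob := by
  cases P.owner t q <;> simp

lemma owner_ne_bob (t : ℕ) (q : Fin P.qubits) :
    P.owner t q ≠ Player.bob ↔ P.owner t q = Player.al := by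
  cases P.owner t q <;> simp

lemma state_succ_of_al {t : ℕ} (h : P.speaker t = Player.al) (x : X) (y : Y) :
    P.state x y (t + 1)
      = embedLocal (fun q => P.owner t q = Player.al) (P.opAl t x).1 *ᵥ P.state x y t := by
  rw [embedLocal_mulVec, state, h]

lemma state_succ_of_bob {t : ℕ} (h : P.speaker t = Player.bob) (x : X) (y : Y) :
    P.state x y (t + 1)
      = embedLocal (fun q => P.owner t q = Player.bob) (P.opBob t y).1 *ᵥ P.state x y t := by
  rw [embedLocal_mulVec, state, h]

lemma sum_normSq_state (x : X) (y : Y) (t : ℕ) : ∑ c, ‖P.state x y t c‖ ^ 2 = 1 := by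
  induction t with
  | zero =>
    rw [Fintype.sum_eq_single fun _ => false]
    · simp [state]
    · intro c hc
      simp [state, hc]
  | succ t ih =>
    cases h : P.speaker t with
    | al => rw [P.state_succ_of_al h, sum_normSq_mulVec (embedLocal_mem_localUnitary _).1, ih]
    | bob => rw [P.state_succ_of_bob h, sum_normSq_mulVec (embedLocal_mem_localUnitary _).1, ih]

variable {P}

lemma resultProb_add_le (p : Player) (x : X) (y : Y) {z z' : Z} (hz : z ≠ z') :
    P.resultProb p x y z + P.resultProb p x y z' ≤ 1 := by
  rw [← P.sum_normSq_state x y P.rounds]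
  unfold resultProb
  rw [← Finset.sum_add_distrib]
  refine Finset.sum_le_sum fun c _ => ?_
  split_ifs with h1 h2 h2
  · exact absurd (h1.symm.trans h2) hz
  all_goals simp

variable [Fintype X] [Fintype Y] {f : X → Y → Z}

lemma divulged_nonpos (h : P.privacyLoss f = 0) {t : ℕ} (ht : t ≤ P.rounds) (p : Player)
    {μ : X × Y → ℝ} (hμ : μ ∈ stdSimplex ℝ (X × Y)) : P.divulged f t p μ ≤ 0 := by
  have : ((P.divulged f t p μ : ℝ) : EReal) ≤ P.privacyLoss f :=
    le_iSup_of_le (⟨t, Nat.lt_succ_of_le ht⟩ : Fin (P.rounds + 1))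
      (le_iSup_of_le p (le_iSup_of_le (⟨μ, hμ⟩ : stdSimplex ℝ (X × Y)) le_rfl))
  rw [h] at this
  exact_mod_cast this

/-- Take the uniform distribution on `(x, y)` and `(x', y)`: given `y` and the common value, Al's
input is a fair bit about which Bob's qubits must say nothing. -/
lemma reducedState_bob_eq (h : P.privacyLoss f = 0) {t : ℕ} (ht : t ≤ P.rounds) {x x' : X} {y : Y}
    (hf : f x y = f x' y) :
    reducedState (fun q => P.owner t q = Player.bob) (P.state x y t)
      = reducedState (fun q => P.owner t q = Player.bob) (P.state x' y t) := by
  classical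
  by_cases hx : x = x'
  · rw [hx]
  refine eq_of_quantumDivulged_nonpos
    (σ := fun x y => reducedState (fun q => P.owner t q = Player.bob) (P.state x y t))
    (fun _ _ => posSemidef_reducedState _ _)
    (fun _ _ => by rw [trace_reducedState, sum_normSq_state, Complex.ofReal_one]) hf hx ?_
  convert divulged_nonpos h ht Player.bob
    (pair_mem_stdSimplex (a := (x, y)) (b := (x', y)) (by simp [hx])) using 1
  unfold divulged
  congr! 3
  dsimp only
  split_ifs with h1 h2 h2 <;>
    first | rfl | (exfalso; simp only [Prod.ext_iff] at h2; tauto)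

lemma reducedState_al_eq (h : P.privacyLoss f = 0) {t : ℕ} (ht : t ≤ P.rounds) {x : X} {y y' : Y}
    (hf : f x y = f x y') :
    reducedState (fun q => P.owner t q = Player.al) (P.state x y t)
      = reducedState (fun q => P.owner t q = Player.al) (P.state x y' t) := by
  classical
  by_cases hy : y = y'
  · rw [hy]
  refine eq_of_quantumDivulged_nonpos (g := fun y x => f x y)
    (σ := fun y x => reducedState (fun q => P.owner t q = Player.al) (P.state x y t))
    (fun _ _ => posSemidef_reducedState _ _)
    (fun _ _ => by rw [trace_reducedState, sum_normSq_state, Complex.ofReal_one]) hf hy ?_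
  convert divulged_nonpos h ht Player.al
    (pair_mem_stdSimplex (a := (x, y)) (b := (x, y')) (by simp [hy])) using 1
  unfold divulged
  congr! 3
  dsimp only
  split_ifs with h1 h2 h2 <;>
    first | rfl | (exfalso; simp only [Prod.ext_iff] at h2; tauto)

/-- Inside a forbidden submatrix, the states on different inputs differ by local unitary
transformations only. -/
lemma exists_localUnitary_state (h : P.privacyLoss f = 0) {A : Set X} {B : Set Y}
    (hrow : ∀ x x', Relation.TransGen (RowRel ((Matrix.of f).submatrix
      (fun a : A => (a : X)) (fun b : B => (b : Y)))) x x')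
    (hcol : ∀ y y', Relation.TransGen (ColRel ((Matrix.of f).submatrix
      (fun a : A => (a : X)) (fun b : B => (b : Y)))) y y')
    (x₀ : A) (y₀ : B) (t : ℕ) (ht : t ≤ P.rounds) :
    ∃ (φ : (Fin P.qubits → Bool) → ℂ)
      (a : A → Matrix (Fin P.qubits → Bool) (Fin P.qubits → Bool) ℂ)
      (b : B → Matrix (Fin P.qubits → Bool) (Fin P.qubits → Bool) ℂ),
      (∀ x, a x ∈ localUnitary fun q => P.owner t q = Player.al) ∧
      (∀ y, b y ∈ localUnitary fun q => P.owner t q = Player.bob) ∧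
      ∀ (x : A) (y : B), P.state x y t = a x *ᵥ b y *ᵥ φ := by
  induction t with
  | zero => exact ⟨_, fun _ => 1, fun _ => 1, fun _ => one_mem _, fun _ => one_mem _,
      fun x y => by rw [one_mulVec, one_mulVec, state]⟩
  | succ t ih =>
    obtain ⟨φ, a, b, ha, hb, hst⟩ := ih (by omega)
    have hab : ∀ {x y}, a x * b y = b y * a x := fun {x y} =>
      (ha x).2.commute (hb y).2 fun q hq => by simp [hq]
    cases hs : P.speaker t with
    | al =>
      -- `U x` is local only on the qubits that Al owned before the round, including those he now
      -- passes on.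
      set U : A → Matrix (Fin P.qubits → Bool) (Fin P.qubits → Bool) ℂ := fun x =>
        embedLocal (fun q => P.owner t q = Player.al) (P.opAl t x).1 * a x with hU
      have hUm : ∀ x, U x ∈ localUnitary fun q => P.owner t q = Player.al := fun x =>
        mul_mem (embedLocal_mem_localUnitary _) (ha x)
      have hst' : ∀ (x : A) (y : B), P.state x y (t + 1) = U x *ᵥ b y *ᵥ φ := by
        intro x y
        rw [P.state_succ_of_al hs, hst, mulVec_mulVec]
      have hown : ∀ q, P.owner t q = Player.bob → P.owner (t + 1) q = Player.bob := by
        intro q hq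
        rw [P.owner_succ t q (by simp [hq, hs]), hq]
      have hown' : ∀ q, P.owner (t + 1) q = Player.al → P.owner t q = Player.al := by
        intro q hq
        by_contra hne
        rw [hown q ((P.owner_ne_al t q).1 hne)] at hq
        exact absurd hq (by simp)
      obtain ⟨w, hw, hwφ⟩ := exists_localUnitary_of_transGen hown'
        (fun q hq => (P.owner_ne_bob (t + 1) q).1 hq) hUm
        (fun y => localUnitary_mono (fun q hq => by simp [hq]) (hb y))
        (r := RowRel ((Matrix.of f).submatrix (fun a : A => (a : X)) (fun b : B => (b : Y))))
        (φ := φ) (by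
          rintro x x' ⟨y, hy⟩
          refine ⟨y, ?_⟩
          rw [← hst', ← hst']
          exact reducedState_bob_eq h ht hy) hrow x₀
      -- The operator of the base row `x₀` is absorbed into the common vector; the others differ
      -- from it by operators on the qubits that Al keeps.
      refine ⟨U x₀ *ᵥ φ, w, b, hw, fun y => localUnitary_mono hown (hb y), fun x y => ?_⟩
      have hc : ∀ x, U x * b y = b y * U x := fun x =>
        (hUm x).2.commute (hb y).2 fun q hq => by simp [hq]
      have hc' : w x * b y = b y * w x :=
        (hw x).2.commute (hb y).2 fun q hq => by simp [hown' q hq]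
      rw [hst', mulVec_mulVec, hc, ← mulVec_mulVec, hwφ, mulVec_mulVec, ← hc', ← mulVec_mulVec]
    | bob =>
      set U : B → Matrix (Fin P.qubits → Bool) (Fin P.qubits → Bool) ℂ := fun y =>
        embedLocal (fun q => P.owner t q = Player.bob) (P.opBob t y).1 * b y with hU
      have hUm : ∀ y, U y ∈ localUnitary fun q => P.owner t q = Player.bob := fun y =>
        mul_mem (embedLocal_mem_localUnitary _) (hb y)
      have hst' : ∀ (y : B) (x : A), P.state x y (t + 1) = U y *ᵥ a x *ᵥ φ := by
        intro y x
        rw [P.state_succ_of_bob hs, hst, mulVec_mulVec _ (a x), hab, ← mulVec_mulVec, mulVec_mulVec]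
      have hown : ∀ q, P.owner t q = Player.al → P.owner (t + 1) q = Player.al := by
        intro q hq
        rw [P.owner_succ t q (by simp [hq, hs]), hq]
      have hown' : ∀ q, P.owner (t + 1) q = Player.bob → P.owner t q = Player.bob := by
        intro q hq
        by_contra hne
        rw [hown q ((P.owner_ne_bob t q).1 hne)] at hq
        exact absurd hq (by simp)
      obtain ⟨w, hw, hwφ⟩ := exists_localUnitary_of_transGen hown'
        (fun q hq => (P.owner_ne_al (t + 1) q).1 hq) hUm
        (fun x => localUnitary_mono (fun q hq => by simp [hq]) (ha x))
        (r := ColRel ((Matrix.of f).submatrix (fun a : A => (a : X)) (fun b : B => (b : Y))))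
        (φ := φ) (by
          rintro y y' ⟨x, hx⟩
          refine ⟨x, ?_⟩
          rw [← hst', ← hst']
          exact reducedState_al_eq h ht hx) hcol y₀
      refine ⟨U y₀ *ᵥ φ, a, w, fun x => localUnitary_mono hown (ha x), hw, fun x y => ?_⟩
      have hc : ∀ y, U y * a x = a x * U y := fun y =>
        (hUm y).2.commute (ha x).2 fun q hq => by simp [hq]
      rw [hst', mulVec_mulVec, hc, ← mulVec_mulVec, hwφ]

end QuantumProtocol

/-- If the values of `f` inside a submatrix do not depend on the column, and all rows are
equivalent, then the submatrix is monochromatic. -/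
lemma isMonochromatic_of_row_const {R C : Type*} {M : Matrix R C Z}
    (hrow : ∀ x x', Relation.TransGen (RowRel M) x x') (h : ∀ x y y', M x y = M x y') :
    IsMonochromatic M := by
  intro x x' y y'
  induction hrow x x' with
  | single hr =>
    obtain ⟨y₁, hy⟩ := hr
    rw [h _ y y₁, hy, h _ y₁ y']
  | tail _ hr ih =>
    obtain ⟨y₁, hy⟩ := hr
    rw [ih, h _ y' y₁, hy, h _ y₁ y']

lemma isMonochromatic_of_col_const {R C : Type*} {M : Matrix R C Z}
    (hcol : ∀ y y', Relation.TransGen (ColRel M) y y') (h : ∀ x x' y, M x y = M x' y) :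
    IsMonochromatic M := by
  intro x x' y y'
  exact isMonochromatic_of_row_const (M := Mᵀ) hcol (fun y x x' => h x x' y) y y' x x'

open Classical in
/-- No quantum protocol with privacy loss `0` computes a function with a forbidden submatrix, not
even for one of the players. -/
theorem not_computes_of_containsForbidden [Fintype X] [Fintype Y] {f : X → Y → Z}
    (hf : ContainsForbidden f) {ε : ℝ} (hε : ε < 1 / 2) {P : QuantumProtocol X Y Z} {p : Player}
    (hP : P.Computes p f ε) : P.privacyLoss f ≠ 0 := by
  intro h
  obtain ⟨A, B, hrow, hcol, hmono⟩ := hf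
  have hne : Nonempty A ∧ Nonempty B := by
    unfold IsMonochromatic at hmono
    push Not at hmono
    obtain ⟨x, _, y, _⟩ := hmono
    exact ⟨⟨x⟩, ⟨y⟩⟩
  obtain ⟨⟨x₀⟩, ⟨y₀⟩⟩ := hne
  obtain ⟨φ, a, b, ha, hb, hst⟩ :=
    P.exists_localUnitary_state h hrow hcol x₀ y₀ P.rounds le_rfl
  -- Two different results cannot both have probability at least `1 - ε > 1/2` on the same inputs.
  have key : ∀ {x x' y y' : _}, P.resultProb p x y (f x y) = P.resultProb p x' y' (f x y) →
      f x y = f x' y' := by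
    intro x x' y y' heq
    by_contra hne
    have h1 := hP x y
    have h2 := hP x' y'
    have h3 := P.resultProb_add_le p x' y' hne
    linarith
  cases p with
  | al =>
    -- On a fixed row the final states differ by operators on Bob's qubits, which Al's measurement
    -- does not see.
    refine hmono (isMonochromatic_of_row_const hrow fun x y y' => key ?_)
    unfold QuantumProtocol.resultProb
    have : ∀ y : B, P.state x y P.rounds = b y *ᵥ a x *ᵥ φ := by
      intro y
      rw [hst, mulVec_mulVec, (ha x).2.commute (hb y).2 fun q hq => by simp [hq], mulVec_mulVec]
    have h' : ∀ c c' : Fin P.qubits → Bool, (∀ q, P.owner P.rounds q = Player.al → c q = c' q) →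
        (P.outAl x (fun q => c q) = f x y ↔ P.outAl x (fun q => c' q) = f x y) := by
      intro c c' hc
      have : (fun q : {q // P.owner P.rounds q = Player.al} => c q)
        = fun q : {q // P.owner P.rounds q = Player.al} => c' q := funext fun q => hc q q.2
      rw [this]
    rw [this, this]
    exact (sum_ite_normSq_mulVec (hb y) (fun q hq => by simp [hq]) _ _ h').trans
      (sum_ite_normSq_mulVec (hb y') (fun q hq => by simp [hq]) _ _ h').symm
  | bob =>
    refine hmono (isMonochromatic_of_col_const hcol fun x x' y => key ?_)
    unfold QuantumProtocol.resultProb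
    have h' : ∀ c c' : Fin P.qubits → Bool, (∀ q, P.owner P.rounds q = Player.bob → c q = c' q) →
        (P.outBob y (fun q => c q) = f x y ↔ P.outBob y (fun q => c' q) = f x y) := by
      intro c c' hc
      have : (fun q : {q // P.owner P.rounds q = Player.bob} => c q)
        = fun q : {q // P.owner P.rounds q = Player.bob} => c' q := funext fun q => hc q q.2
      rw [this]
    rw [hst, hst]
    exact (sum_ite_normSq_mulVec (ha x) (fun q hq => by simp [hq]) _ _ h').trans
      (sum_ite_normSq_mulVec (ha x') (fun q hq => by simp [hq]) _ _ h').symm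

end QuantumLowerBound

/-! ### Zero information forces equal classical distributions -/

section ShannonEntropy

open Classical in
/-- The probability that `W = w`. -/
noncomputable def massAt {Ω α : Type*} [Fintype Ω] (pr : Ω → ℝ) (W : Ω → α) (w : α) : ℝ :=
  ∑ ω, if W ω = w then pr ω else 0

variable {Ω I N α β γ : Type*} [Fintype Ω] [Fintype I] [Fintype N]

lemma massAt_nonneg {pr : Ω → ℝ} (h : ∀ ω, 0 ≤ pr ω) (W : Ω → α) (w : α) : 0 ≤ massAt pr W w :=
  Finset.sum_nonneg fun ω _ => by
    split_ifs
    exacts [h ω, le_rfl]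

lemma massAt_eq_zero {pr : Ω → ℝ} {W : Ω → α} {w : α} (h : ∀ ω, W ω ≠ w) : massAt pr W w = 0 := by
  simp [massAt, h]

lemma sum_massAt {pr : Ω → ℝ} {W : Ω → α} {s : Finset α} (hs : ∀ ω, W ω ∈ s) :
    ∑ w ∈ s, massAt pr W w = ∑ ω, pr ω := by
  unfold massAt
  rw [Finset.sum_comm]
  exact Finset.sum_congr rfl fun ω _ => (Finset.sum_eq_single (W ω) (fun w _ hw => if_neg hw.symm)
    fun h => absurd (hs ω) h).trans (if_pos rfl)

/-- Allowing any finite set that carries the mass lets the joint entropies below be summed over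
product sets. -/
lemma shannonEntropy_eq_sum {pr : Ω → ℝ} {W : Ω → α} {s : Finset α}
    (hs : ∀ w, w ∉ s → massAt pr W w = 0) :
    shannonEntropy pr W = ∑ w ∈ s, negMulLogTwo (massAt pr W w) := by
  classical
  have h1 : shannonEntropy pr W
      = ∑ w ∈ Finset.univ.image W, negMulLogTwo (massAt pr W w) := by
    unfold shannonEntropy massAt negMulLogTwo
    congr!
  rw [h1]
  refine (Finset.sum_subset (Finset.subset_union_left (s₂ := s)) fun w _ hw => ?_).trans
    (Finset.sum_subset (Finset.subset_union_right (s₁ := Finset.univ.image W))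
      fun w _ hw => ?_).symm
  · rw [massAt_eq_zero fun ω h => hw (Finset.mem_image.2 ⟨ω, Finset.mem_univ _, h⟩),
      negMulLogTwo_zero]
  · rw [hs w hw, negMulLogTwo_zero]

open Classical in
lemma massAt_pair {i j : I} (hij : i ≠ j) (ν : N → ℝ) (T : I × N → α) (τ : α) :
    massAt (fun ω : I × N => (if ω.1 = i ∨ ω.1 = j then 2⁻¹ else 0) * ν ω.2) T τ
      = 2⁻¹ * massAt ν (fun n => T (i, n)) τ + 2⁻¹ * massAt ν (fun n => T (j, n)) τ := by
  unfold massAt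
  rw [Fintype.sum_prod_type, Fintype.sum_eq_add i j hij]
  · simp [Finset.mul_sum]
  · intro k hk
    simp [hk.1, hk.2]

lemma massAt_const {ν : N → ℝ} (hν : ∑ n, ν n = 1) (a τ : α) [Decidable (a = τ)] :
    massAt ν (fun _ => a) τ = if a = τ then 1 else 0 := by
  classical
  unfold massAt
  split_ifs <;> simp [*]

lemma massAt_prodMk_const {ν : N → ℝ} (u : N → α) (a : β) (τ : α × β) [Decidable (a = τ.2)] :
    massAt ν (fun n => (u n, a)) τ = if a = τ.2 then massAt ν u τ.1 else 0 := by
  classical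
  obtain ⟨v, b⟩ := τ
  unfold massAt
  split_ifs with h
  · refine Finset.sum_congr rfl fun n _ => ?_
    simp [show a = b from h]
  · exact Finset.sum_eq_zero fun n _ => if_neg fun h' => h (congrArg Prod.snd h')

open Classical in
/-- If no information is divulged when the inputs are `i` or `j` with equal probabilities, then the
view is distributed in the same way on both inputs. -/
lemma massAt_eq_of_condMutualInfo_nonpos {i j : I} {ν : N → ℝ} (hν : ν ∈ stdSimplex ℝ N)
    {U : I × N → α} {V : I → β} {W : I → γ} (hV : V i ≠ V j) (hW : W i = W j)
    (h : condMutualInfo (fun ω : I × N => (if ω.1 = i ∨ ω.1 = j then 2⁻¹ else 0) * ν ω.2)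
      U (fun ω => V ω.1) (fun ω => W ω.1) ≤ 0) (u : α) :
    massAt ν (fun n => U (i, n)) u = massAt ν (fun n => U (j, n)) u := by
  have hij : i ≠ j := fun h => hV (congrArg V h)
  set F : Finset α := Finset.univ.image U with hF
  have hFi : ∀ k n, U (k, n) ∈ F := fun k n => Finset.mem_image_of_mem _ (Finset.mem_univ _)
  have hF0 : ∀ k u, u ∉ F → massAt ν (fun n => U (k, n)) u = 0 := fun k u hu =>
    massAt_eq_zero fun n hn => hu (hn ▸ hFi k n)
  unfold condMutualInfo at h
  dsimp only at h
  rw [shannonEntropy_eq_sum (s := F ×ˢ {W i}) (by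
      rintro ⟨u, w⟩ hu
      rw [massAt_pair hij]
      dsimp only
      rw [massAt_prodMk_const, massAt_prodMk_const]
      by_cases hw : W i = w
      · have : u ∉ F := fun h => hu (by simp [h, hw])
        simp [hF0 _ u this]
      · simp [hw, ← hW]),
    shannonEntropy_eq_sum (s := {(V i, W i), (V j, W i)}) (by
      intro p hp
      rw [massAt_pair hij]
      dsimp only
      rw [massAt_const hν.2, massAt_const hν.2, if_neg, if_neg]
      · simp
      all_goals
        rintro rfl
        exact hp (by simp [hW])),
    shannonEntropy_eq_sum (s := {W i}) (by
      intro p hp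
      rw [massAt_pair hij]
      dsimp only
      rw [massAt_const hν.2, massAt_const hν.2, if_neg, if_neg]
      · simp
      all_goals
        rintro rfl
        exact hp (by simp [hW])),
    shannonEntropy_eq_sum (s := F ×ˢ {(V i, W i), (V j, W i)}) (by
      rintro ⟨u, w⟩ hu
      rw [massAt_pair hij]
      dsimp only
      rw [massAt_prodMk_const, massAt_prodMk_const]
      by_cases hw : w = (V i, W i) ∨ w = (V j, W i)
      · have : u ∉ F := fun h => hu (by simp [h, hw])
        simp [hF0 _ u this]
      · push Not at hw
        simp [← hW, hw.1.symm, hw.2.symm])] at h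
  have hne : (V i, W i) ≠ (V j, W i) := fun h => hV (congrArg Prod.fst h)
  have hhalf : negMulLogTwo (2⁻¹ : ℝ) = 2⁻¹ := by simpa using negMulLogTwo_half 1
  rw [Finset.sum_product, Finset.sum_product, Finset.sum_pair hne, Finset.sum_singleton] at h
  simp only [Finset.sum_singleton, Finset.sum_pair hne, massAt_pair hij, massAt_prodMk_const,
    massAt_const hν.2, ← hW, if_true, if_neg hne, if_neg hne.symm, mul_one, mul_zero, add_zero,
    zero_add, hhalf, negMulLogTwo_half] at h
  -- As in the quantum case, the bit of the fair input cancels, and the entropy of the average is at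
  -- most the average of the entropies.
  rw [show (2⁻¹ + 2⁻¹ : ℝ) = 1 by norm_num, negMulLogTwo_one, Finset.sum_add_distrib,
    Finset.sum_add_distrib, Finset.sum_add_distrib, ← Finset.mul_sum, ← Finset.mul_sum,
    ← Finset.mul_sum, ← Finset.mul_sum, sum_massAt (fun n => hFi i n),
    sum_massAt (fun n => hFi j n), hν.2] at h
  by_cases hu : u ∈ F
  · refine eq_of_sum_negMulLogTwo_average_le (s := F) (fun u _ => massAt_nonneg hν.1 _ u)
      (fun u _ => massAt_nonneg hν.1 _ u) ?_ u hu
    rw [Finset.sum_add_distrib, ← Finset.mul_sum, ← Finset.mul_sum]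
    linarith
  · rw [hF0 _ u hu, hF0 _ u hu]

end ShannonEntropy

/-! ### Forbidden submatrices exclude private classical protocols -/

section ClassicalLowerBound

variable {X Y Z : Type*}

namespace ClassicalProtocol

variable (P : ClassicalProtocol X Y Z)

/-- `m` can be the transcript of the first `t` rounds if Al has input `x` and coins `r`. -/
def ConsistentAl (x : X) (r : Fin P.coinsAl) : ℕ → List (List Bool) → Prop
  | 0, m => m = []
  | t + 1, m => ∃ m' w, m = m' ++ [w] ∧ ConsistentAl x r t m' ∧
      (P.speaker t = Player.al → w = P.msgAl t x r m')

/-- `m` can be the transcript of the first `t` rounds if Bob has input `y` and coins `s`. -/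
def ConsistentBob (y : Y) (s : Fin P.coinsBob) : ℕ → List (List Bool) → Prop
  | 0, m => m = []
  | t + 1, m => ∃ m' w, m = m' ++ [w] ∧ ConsistentBob y s t m' ∧
      (P.speaker t = Player.bob → w = P.msgBob t y s m')

/-- The rectangle property: each message constrains only its sender, so a transcript occurs exactly
if it suits each player separately. -/
lemma transcript_eq_iff (x : X) (y : Y) (r : Fin P.coinsAl) (s : Fin P.coinsBob) (t : ℕ)
    (m : List (List Bool)) : P.transcript x y r s t = m ↔
      P.ConsistentAl x r t m ∧ P.ConsistentBob y s t m := by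
  induction t generalizing m with
  | zero => simp [transcript, ConsistentAl, ConsistentBob, eq_comm]
  | succ t ih =>
    constructor
    · rintro rfl
      have h := (ih _).1 rfl
      exact ⟨⟨_, _, rfl, h.1, fun hs => by rw [hs]⟩, ⟨_, _, rfl, h.2, fun hs => by rw [hs]⟩⟩
    · rintro ⟨⟨m', w, rfl, h1, h2⟩, m'', w', h3, h4, h5⟩
      obtain ⟨rfl, hw⟩ := List.append_inj' h3 rfl
      simp only [List.cons.injEq, and_true] at hw
      subst hw
      rw [transcript, (ih m').2 ⟨h1, h4⟩]
      cases hs : P.speaker t with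
      | al => simp only [← h2 hs]
      | bob => simp only [← h5 hs]

open Classical in
/-- The probability that Al's coins are consistent with the transcript `m`. -/
noncomputable def weightAl (t : ℕ) (x : X) (m : List (List Bool)) : ℝ :=
  ∑ r, if P.ConsistentAl x r t m then P.distAl.1 r else 0

open Classical in
/-- The probability that Bob's coins are consistent with the transcript `m`. -/
noncomputable def weightBob (t : ℕ) (y : Y) (m : List (List Bool)) : ℝ :=
  ∑ s, if P.ConsistentBob y s t m then P.distBob.1 s else 0

/-- The joint distribution of the coins. -/
noncomputable def coinDist (c : Fin P.coinsAl × Fin P.coinsBob) : ℝ :=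
  P.distAl.1 c.1 * P.distBob.1 c.2

lemma coinDist_mem_stdSimplex : P.coinDist ∈ stdSimplex ℝ (Fin P.coinsAl × Fin P.coinsBob) := by
  refine ⟨fun c => mul_nonneg (P.distAl.2.1 _) (P.distBob.2.1 _), ?_⟩
  unfold coinDist
  rw [Fintype.sum_prod_type, ← Finset.sum_mul_sum, P.distAl.2.2, P.distBob.2.2, one_mul]

/-- The distribution of the transcript of the first `t` rounds. -/
noncomputable def transcriptDist (t : ℕ) (x : X) (y : Y) (m : List (List Bool)) : ℝ :=
  massAt P.coinDist (fun c => P.transcript x y c.1 c.2 t) m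

/-- The coins are independent, so the rectangle property turns into a product of probabilities. -/
lemma transcriptDist_eq_mul (t : ℕ) (x : X) (y : Y) (m : List (List Bool)) :
    P.transcriptDist t x y m = P.weightAl t x m * P.weightBob t y m := by
  unfold transcriptDist massAt weightAl weightBob coinDist
  rw [Fintype.sum_prod_type, Finset.sum_mul_sum]
  refine Finset.sum_congr rfl fun r _ => Finset.sum_congr rfl fun s _ => ?_
  by_cases h1 : P.ConsistentAl x r t m <;> by_cases h2 : P.ConsistentBob y s t m <;>
    simp [P.transcript_eq_iff, h1, h2]

lemma weightAl_nonneg (t : ℕ) (x : X) (m : List (List Bool)) : 0 ≤ P.weightAl t x m :=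
  Finset.sum_nonneg fun r _ => by
    split_ifs
    exacts [P.distAl.2.1 r, le_rfl]

lemma weightBob_nonneg (t : ℕ) (y : Y) (m : List (List Bool)) : 0 ≤ P.weightBob t y m :=
  Finset.sum_nonneg fun s _ => by
    split_ifs
    exacts [P.distBob.2.1 s, le_rfl]

lemma weightAl_succ_le (t : ℕ) (x : X) (m : List (List Bool)) (w : List Bool) :
    P.weightAl (t + 1) x (m ++ [w]) ≤ P.weightAl t x m := by
  refine Finset.sum_le_sum fun r _ => ?_
  split_ifs with h1 h2
  · rfl
  · obtain ⟨m', w', h, h', _⟩ := h1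
    exact absurd ((List.append_inj' h rfl).1 ▸ h') h2
  · exact P.distAl.2.1 r
  · rfl

lemma weightBob_succ_le (t : ℕ) (y : Y) (m : List (List Bool)) (w : List Bool) :
    P.weightBob (t + 1) y (m ++ [w]) ≤ P.weightBob t y m := by
  refine Finset.sum_le_sum fun s _ => ?_
  split_ifs with h1 h2
  · rfl
  · obtain ⟨m', w', h, h', _⟩ := h1
    exact absurd ((List.append_inj' h rfl).1 ▸ h') h2
  · exact P.distBob.2.1 s
  · rfl

/-- A message of Bob puts no condition on Al's coins. -/
lemma weightAl_succ_of_bob {t : ℕ} (hs : P.speaker t = Player.bob) (x : X)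
    (m : List (List Bool)) (w : List Bool) :
    P.weightAl (t + 1) x (m ++ [w]) = P.weightAl t x m := by
  have : ∀ r, P.ConsistentAl x r (t + 1) (m ++ [w]) ↔ P.ConsistentAl x r t m := fun r =>
    ⟨fun ⟨m', w', h, h', _⟩ => (List.append_inj' h rfl).1 ▸ h',
      fun h => ⟨m, w, rfl, h, fun h => by simp [hs] at h⟩⟩
  classical
  simp only [weightAl, this]

lemma weightBob_succ_of_al {t : ℕ} (hs : P.speaker t = Player.al) (y : Y)
    (m : List (List Bool)) (w : List Bool) :
    P.weightBob (t + 1) y (m ++ [w]) = P.weightBob t y m := by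
  have : ∀ s, P.ConsistentBob y s (t + 1) (m ++ [w]) ↔ P.ConsistentBob y s t m := fun s =>
    ⟨fun ⟨m', w', h, h', _⟩ => (List.append_inj' h rfl).1 ▸ h',
      fun h => ⟨m, w, rfl, h, fun h => by simp [hs] at h⟩⟩
  classical
  simp only [weightBob, this]

lemma transcriptDist_succ_nil (t : ℕ) (x : X) (y : Y) : P.transcriptDist (t + 1) x y [] = 0 :=
  massAt_eq_zero fun c => by simp [transcript]

/-- Either `b = b'`, or `a = 0` and then `a' = 0`. It carries an equality of transcript
probabilities over to a smaller factor of one player. -/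
lemma mul_eq_mul_of_le {a a' b b' : ℝ} (h0 : 0 ≤ a') (hle : a' ≤ a) (h : a * b = a * b') :
    a' * b = a' * b' := by
  rcases mul_eq_mul_left_iff.1 h with h | h
  · rw [h]
  · rw [le_antisymm (h ▸ hle) h0, zero_mul, zero_mul]

variable {P} [Fintype X] [Fintype Y] {f : X → Y → Z}

lemma divulged_nonpos (h : P.privacyLoss f = 0) {t : ℕ} (ht : t ≤ P.rounds) (p : Player)
    {μ : X × Y → ℝ} (hμ : μ ∈ stdSimplex ℝ (X × Y)) : P.divulged f t p μ ≤ 0 := by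
  have : ((P.divulged f t p μ : ℝ) : EReal) ≤ P.privacyLoss f :=
    le_iSup_of_le (⟨t, Nat.lt_succ_of_le ht⟩ : Fin (P.rounds + 1))
      (le_iSup_of_le p (le_iSup_of_le (⟨μ, hμ⟩ : stdSimplex ℝ (X × Y)) le_rfl))
  rw [h] at this
  exact_mod_cast this

omit [Fintype X] [Fintype Y] in
lemma sum_massAt_prodMk {N C α : Type*} [Fintype N] [Fintype C] (ν : N → ℝ) (c : N → C)
    (u : N → α) (m : α) : ∑ k, massAt ν (fun n => (c n, u n)) (k, m) = massAt ν u m := by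
  classical
  unfold massAt
  rw [Finset.sum_comm]
  refine Finset.sum_congr rfl fun n _ => ?_
  rw [Fintype.sum_eq_single (c n)]
  · simp
  · intro k hk
    simp [hk.symm]

/-- Privacy equates the joint laws of Bob's coins and the transcript; sum over the coins. -/
lemma transcriptDist_eq_row (h : P.privacyLoss f = 0) {t : ℕ} (ht : t ≤ P.rounds) {x x' : X} {y : Y}
    (hf : f x y = f x' y) : P.transcriptDist t x y = P.transcriptDist t x' y := by
  classical
  by_cases hx : x = x'
  · rw [hx]
  have hp : (x, y) ≠ (x', y) := by simp [hx]
  have key := massAt_eq_of_condMutualInfo_nonpos P.coinDist_mem_stdSimplex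
    (U := fun ω : (X × Y) × Fin P.coinsAl × Fin P.coinsBob =>
      (ω.2.2, P.transcript ω.1.1 ω.1.2 ω.2.1 ω.2.2 t))
    (V := fun i : X × Y => i.1) (W := fun i : X × Y => (i.2, f i.1 i.2))
    (i := (x, y)) (j := (x', y)) hx (by simp [hf])
    (by
      convert divulged_nonpos h ht Player.bob (pair_mem_stdSimplex hp) using 1
      unfold divulged coinDist
      congr!)
  funext m
  unfold transcriptDist
  rw [← sum_massAt_prodMk _ (fun c => c.2), ← sum_massAt_prodMk _ (fun c => c.2)]
  exact Finset.sum_congr rfl fun k _ => key (k, m)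

lemma transcriptDist_eq_col (h : P.privacyLoss f = 0) {t : ℕ} (ht : t ≤ P.rounds) {x : X} {y y' : Y}
    (hf : f x y = f x y') : P.transcriptDist t x y = P.transcriptDist t x y' := by
  classical
  by_cases hy : y = y'
  · rw [hy]
  have hp : (x, y) ≠ (x, y') := by simp [hy]
  have key := massAt_eq_of_condMutualInfo_nonpos P.coinDist_mem_stdSimplex
    (U := fun ω : (X × Y) × Fin P.coinsAl × Fin P.coinsBob =>
      (ω.2.1, P.transcript ω.1.1 ω.1.2 ω.2.1 ω.2.2 t))
    (V := fun i : X × Y => i.2) (W := fun i : X × Y => (i.1, f i.1 i.2))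
    (i := (x, y)) (j := (x, y')) hy (by simp [hf])
    (by
      convert divulged_nonpos h ht Player.al (pair_mem_stdSimplex hp) using 1
      unfold divulged coinDist
      congr!)
  funext m
  unfold transcriptDist
  rw [← sum_massAt_prodMk _ (fun c => c.1), ← sum_massAt_prodMk _ (fun c => c.1)]
  exact Finset.sum_congr rfl fun k _ => key (k, m)

/-- Inside a forbidden submatrix, the distribution of the transcript does not depend on the
inputs. -/
lemma isMonochromatic_transcriptDist (h : P.privacyLoss f = 0) {A : Set X} {B : Set Y}
    (hrow : ∀ x x', Relation.TransGen (RowRel ((Matrix.of f).submatrix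
      (fun a : A => (a : X)) (fun b : B => (b : Y)))) x x')
    (hcol : ∀ y y', Relation.TransGen (ColRel ((Matrix.of f).submatrix
      (fun a : A => (a : X)) (fun b : B => (b : Y)))) y y')
    (t : ℕ) (ht : t ≤ P.rounds) :
    IsMonochromatic (Matrix.of fun (x : A) (y : B) => P.transcriptDist t x y) := by
  induction t with
  | zero => intro x x' y y'; rfl
  | succ t ih =>
    have ih := ih (by omega)
    cases hs : P.speaker t with
    | al =>
      -- Rows related for `f` are related for the transcript distribution by privacy, so only
      -- independence of the column is left to show.
      refine isMonochromatic_of_row_const (fun x x' => Relation.TransGen.mono ?_ _ _ (hrow x x'))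
        fun x y y' => ?_
      · rintro x x' ⟨y, hy⟩
        exact ⟨y, transcriptDist_eq_row h ht hy⟩
      · funext m
        obtain rfl | ⟨m, w, rfl⟩ := m.eq_nil_or_concat'
        · exact (P.transcriptDist_succ_nil _ _ _).trans (P.transcriptDist_succ_nil _ _ _).symm
        -- Al's message shrinks his own factor and leaves Bob's alone, so the equality of products
        -- at time `t` persists.
        · have := congrFun (ih x x y y') m
          simp only [Matrix.of_apply, transcriptDist_eq_mul] at this ⊢
          rw [P.weightBob_succ_of_al hs, P.weightBob_succ_of_al hs]
          exact mul_eq_mul_of_le (P.weightAl_nonneg _ _ _) (P.weightAl_succ_le _ _ _ _) this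
    | bob =>
      refine isMonochromatic_of_col_const (fun y y' => Relation.TransGen.mono ?_ _ _ (hcol y y'))
        fun x x' y => ?_
      · rintro y y' ⟨x, hx⟩
        exact ⟨x, transcriptDist_eq_col h ht hx⟩
      · funext m
        obtain rfl | ⟨m, w, rfl⟩ := m.eq_nil_or_concat'
        · exact (P.transcriptDist_succ_nil _ _ _).trans (P.transcriptDist_succ_nil _ _ _).symm
        · have := congrFun (ih x x' y y) m
          simp only [Matrix.of_apply, transcriptDist_eq_mul] at this ⊢
          rw [P.weightAl_succ_of_bob hs, P.weightAl_succ_of_bob hs, mul_comm,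
            mul_comm _ (P.weightBob _ _ _)]
          refine mul_eq_mul_of_le (P.weightBob_nonneg _ _ _) (P.weightBob_succ_le _ _ _ _) ?_
          rw [mul_comm, this, mul_comm]

variable (P)

omit [Fintype X] [Fintype Y] in
lemma resultProb_add_le (p : Player) (x : X) (y : Y) {z z' : Z} (hz : z ≠ z') :
    P.resultProb p x y z + P.resultProb p x y z' ≤ 1 := by
  rw [← P.coinDist_mem_stdSimplex.2, Fintype.sum_prod_type]
  unfold resultProb coinDist
  rw [← Finset.sum_add_distrib]
  refine Finset.sum_le_sum fun r _ => ?_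
  rw [← Finset.sum_add_distrib]
  refine Finset.sum_le_sum fun s _ => ?_
  have := mul_nonneg (P.distAl.2.1 r) (P.distBob.2.1 s)
  split_ifs with h1 h2 h2
  · exact absurd (h1.symm.trans h2) hz
  all_goals simp [this]

-- The joint probability of coins `r` and transcript `m` is a part of Al's factor times Bob's
-- factor. Equal transcript probabilities thus give equal joint ones by `mul_eq_mul_of_le`, and
-- these determine the law of Al's result.
omit [Fintype X] [Fintype Y] in
lemma resultProb_al_eq {x : X} {y y' : Y}
    (h : P.transcriptDist P.rounds x y = P.transcriptDist P.rounds x y') (z : Z) :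
    P.resultProb Player.al x y z = P.resultProb Player.al x y' z := by
  classical
  set F : Finset (List (List Bool)) :=
    Finset.univ.image (fun c : Fin P.coinsAl × Fin P.coinsBob => P.transcript x y c.1 c.2 P.rounds)
    ∪ Finset.univ.image (fun c : Fin P.coinsAl × Fin P.coinsBob =>
        P.transcript x y' c.1 c.2 P.rounds) with hF
  have hmem : ∀ r s, P.transcript x y r s P.rounds ∈ F := fun r s =>
    Finset.mem_union_left _ (Finset.mem_image_of_mem _ (Finset.mem_univ (r, s)))
  have hmem' : ∀ r s, P.transcript x y' r s P.rounds ∈ F := fun r s =>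
    Finset.mem_union_right _ (Finset.mem_image_of_mem _ (Finset.mem_univ (r, s)))
  have key : ∀ v : Y, (∀ r s, P.transcript x v r s P.rounds ∈ F) →
      P.resultProb Player.al x v z = ∑ r, ∑ m ∈ F, if P.outAl x r m = z then
        (if P.ConsistentAl x r P.rounds m then P.distAl.1 r else 0) * P.weightBob P.rounds v m
        else 0 := by
    intro v hv
    unfold resultProb weightBob
    refine Finset.sum_congr rfl fun r _ => ?_
    have : ∀ m, (if P.outAl x r m = z then
        (if P.ConsistentAl x r P.rounds m then P.distAl.1 r else 0)
          * ∑ s, (if P.ConsistentBob v s P.rounds m then P.distBob.1 s else 0) else 0)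
        = ∑ s, if P.transcript x v r s P.rounds = m then
          (if P.outAl x r m = z then P.distAl.1 r * P.distBob.1 s else 0) else 0 := by
      intro m
      by_cases hz : P.outAl x r m = z
      · rw [if_pos hz, Finset.mul_sum]
        refine Finset.sum_congr rfl fun s _ => ?_
        by_cases h1 : P.ConsistentAl x r P.rounds m <;>
          by_cases h2 : P.ConsistentBob v s P.rounds m <;>
          simp [P.transcript_eq_iff, h1, h2, hz]
      · simp [hz]
    simp only [this]
    rw [Finset.sum_comm]
    refine Finset.sum_congr rfl fun s _ => ?_
    rw [Finset.sum_ite_eq, if_pos (hv r s)]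
    rfl
  rw [key y hmem, key y' hmem']
  refine Finset.sum_congr rfl fun r _ => Finset.sum_congr rfl fun m _ => ?_
  congr 1
  have := congrFun h m
  rw [transcriptDist_eq_mul, transcriptDist_eq_mul] at this
  refine mul_eq_mul_of_le ?_ ?_ this
  · split_ifs
    exacts [P.distAl.2.1 r, le_rfl]
  · exact Finset.single_le_sum
      (f := fun r => if P.ConsistentAl x r P.rounds m then P.distAl.1 r else 0) (fun r _ => by
        split_ifs
        exacts [P.distAl.2.1 r, le_rfl]) (Finset.mem_univ r)

end ClassicalProtocol

/-- No classical protocol with privacy loss `0` computes a function with a forbidden submatrix. -/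
theorem not_containsForbidden_of_classicalPrivate [Fintype X] [Fintype Y] {f : X → Y → Z} {ε : ℝ}
    (hε : ε < 1 / 2) (h : ClassicalPrivate f ε) : ¬ ContainsForbidden f := by
  rintro ⟨A, B, hrow, hcol, hmono⟩
  obtain ⟨P, hP, hloss⟩ := h
  have hT := ClassicalProtocol.isMonochromatic_transcriptDist hloss hrow hcol P.rounds le_rfl
  refine hmono (isMonochromatic_of_row_const hrow fun x y y' => ?_)
  by_contra hne
  have h1 := hP Player.al x y
  have h2 := hP Player.al x y'
  have h3 := P.resultProb_add_le Player.al x y' hne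
  rw [P.resultProb_al_eq (hT x x y y')] at h1
  simp only [Matrix.submatrix_apply, Matrix.of_apply] at h3
  linarith

end ClassicalLowerBound

/-! ### Splitting a matrix without forbidden submatrices into monochromatic blocks -/

section Blocks

variable {X Y Z : Type*}

/-- The relation `≡'` on the rows of the submatrix of `f` with rows `A` and columns `B`. -/
def RowLink (f : X → Y → Z) (A : Set X) (B : Set Y) (x x' : X) : Prop :=
  x ∈ A ∧ x' ∈ A ∧ ∃ y ∈ B, f x y = f x' y

/-- The rows that are equivalent to `x` in the submatrix of `f` with rows `A` and columns `B`. -/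
def rowClass (f : X → Y → Z) (A : Set X) (B : Set Y) (x : X) : Set X :=
  {x' | Relation.TransGen (RowLink f A B) x x'}

variable {f : X → Y → Z} {A : Set X} {B : Set Y} {x x' : X} {y : Y}

lemma transGen_rowLink_symm (h : Relation.TransGen (RowLink f A B) x x') :
    Relation.TransGen (RowLink f A B) x' x := by
  have : Std.Symm (RowLink f A B) := ⟨fun _ _ ⟨h1, h2, y, hy, h⟩ => ⟨h2, h1, y, hy, h.symm⟩⟩
  exact Relation.TransGen.stdSymm.symm _ _ h

lemma mem_rowClass_of_eq (hx : x ∈ A) (hx' : x' ∈ A) (hy : y ∈ B) (h : f x y = f x' y) :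
    x' ∈ rowClass f A B x :=
  Relation.TransGen.single ⟨hx, hx', y, hy, h⟩

lemma rowClass_subset : rowClass f A B x ⊆ A := by
  intro x' h
  obtain ⟨b, _, h⟩ := Relation.TransGen.tail'_iff.1 h
  exact h.2.1

lemma rowClass_eq_of_mem (h : x' ∈ rowClass f A B x) : rowClass f A B x' = rowClass f A B x := by
  ext x''
  exact ⟨fun h' => Relation.TransGen.trans h h',
    fun h' => (transGen_rowLink_symm h).trans h'⟩

/-- Links in `X` let `A` and `B` vary with the round; forbidden submatrices are defined on subtypes.
A chain of links stays in `A`, so it lifts. -/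
lemma transGen_rowRel_of_rowLink {x x' : A}
    (h : Relation.TransGen (RowLink f A B) (x : X) x') :
    Relation.TransGen (RowRel ((Matrix.of f).submatrix
      (fun a : A => (a : X)) (fun b : B => (b : Y)))) x x' := by
  obtain ⟨x', hx'⟩ := x'
  change Relation.TransGen (RowLink f A B) x x' at h
  induction h with
  | single h => exact Relation.TransGen.single ⟨⟨_, h.2.2.choose_spec.1⟩, h.2.2.choose_spec.2⟩
  | tail _ h ih => exact (ih h.1).tail ⟨⟨_, h.2.2.choose_spec.1⟩, h.2.2.choose_spec.2⟩

/-- The submatrix that contains the entry `(x, y)` after `t` rounds, when the players alternately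
announce the equivalence class of their inputs inside the present submatrix. -/
noncomputable def block (f : X → Y → Z) : ℕ → X → Y → Set X × Set Y
  | 0, _, _ => (Set.univ, Set.univ)
  | t + 1, x, y =>
    if Even t then (rowClass f (block f t x y).1 (block f t x y).2 x, (block f t x y).2)
    else ((block f t x y).1, rowClass (fun y x => f x y) (block f t x y).2 (block f t x y).1 y)

lemma block_succ_of_even {t : ℕ} (ht : Even t) (x : X) (y : Y) : block f (t + 1) x y
    = (rowClass f (block f t x y).1 (block f t x y).2 x, (block f t x y).2) := by
  rw [block, if_pos ht]

lemma block_succ_of_not_even {t : ℕ} (ht : ¬ Even t) (x : X) (y : Y) : block f (t + 1) x y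
    = ((block f t x y).1,
      rowClass (fun y x => f x y) (block f t x y).2 (block f t x y).1 y) := by
  rw [block, if_neg ht]

lemma mem_block (f : X → Y → Z) (t : ℕ) (x : X) (y : Y) :
    x ∈ (block f t x y).1 ∧ y ∈ (block f t x y).2 := by
  induction t with
  | zero => exact ⟨trivial, trivial⟩
  | succ t ih =>
    by_cases ht : Even t
    · rw [block_succ_of_even ht]
      exact ⟨mem_rowClass_of_eq ih.1 ih.1 ih.2 rfl, ih.2⟩
    · rw [block_succ_of_not_even ht]
      exact ⟨ih.1, mem_rowClass_of_eq ih.2 ih.2 ih.1 rfl⟩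

lemma block_succ_le (f : X → Y → Z) (t : ℕ) (x : X) (y : Y) :
    block f (t + 1) x y ≤ block f t x y := by
  by_cases ht : Even t
  · rw [block_succ_of_even ht]
    exact ⟨rowClass_subset, le_rfl⟩
  · rw [block_succ_of_not_even ht]
    exact ⟨le_rfl, rowClass_subset⟩

/-- The blocks of a given time partition the matrix into rectangles, since each class depends only
on the block and not on its representative. -/
lemma block_eq_of_mem {t : ℕ} {x x' : X} {y y' : Y} (hx : x' ∈ (block f t x y).1)
    (hy : y' ∈ (block f t x y).2) : block f t x' y' = block f t x y := by
  induction t with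
  | zero => rfl
  | succ t ih =>
    have ih := ih ((block_succ_le f t x y).1 hx) ((block_succ_le f t x y).2 hy)
    by_cases ht : Even t
    · rw [block_succ_of_even ht] at hx hy ⊢
      rw [block_succ_of_even ht, ih, rowClass_eq_of_mem hx]
    · rw [block_succ_of_not_even ht] at hx hy ⊢
      rw [block_succ_of_not_even ht, ih, rowClass_eq_of_mem hy]

lemma block_eq_of_block_succ_eq {t : ℕ} {x x' : X} {y y' : Y}
    (h : block f (t + 1) x y = block f (t + 1) x' y') : block f t x y = block f t x' y' := by
  have hm := mem_block f (t + 1) x y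
  rw [h] at hm
  exact block_eq_of_mem ((block_succ_le f t x' y').1 hm.1) ((block_succ_le f t x' y').2 hm.2)

/-- The source of privacy: `y` belongs to the common block, so it links `x` and `x'` there and Al's
announcement cannot separate them; Bob's does not involve the row. -/
lemma block_eq_of_row {x x' : X} {y : Y} (h : f x y = f x' y) (t : ℕ) :
    block f t x y = block f t x' y := by
  induction t with
  | zero => rfl
  | succ t ih =>
    by_cases ht : Even t
    · rw [block_succ_of_even ht, block_succ_of_even ht, ih,
        rowClass_eq_of_mem (mem_rowClass_of_eq (mem_block f t x' y).1
          (ih ▸ (mem_block f t x y).1) (mem_block f t x' y).2 h.symm)]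
    · rw [block_succ_of_not_even ht, block_succ_of_not_even ht, ih]

lemma block_eq_of_col {x : X} {y y' : Y} (h : f x y = f x y') (t : ℕ) :
    block f t x y = block f t x y' := by
  induction t with
  | zero => rfl
  | succ t ih =>
    by_cases ht : Even t
    · rw [block_succ_of_even ht, block_succ_of_even ht, ih]
    · rw [block_succ_of_not_even ht, block_succ_of_not_even ht, ih,
        rowClass_eq_of_mem (f := fun y x => f x y) (mem_rowClass_of_eq (mem_block f t x y').2
          (ih ▸ (mem_block f t x y).2) (mem_block f t x y').1 h.symm)]

/-- Two successive rounds involve both players. If neither shrinks the block, all its rows and all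
its columns are equivalent, so only monochromaticity keeps it from being forbidden. -/
lemma eq_of_block_stable (hf : ¬ ContainsForbidden f) {t : ℕ} {x : X} {y : Y}
    (h1 : block f (t + 1) x y = block f t x y) (h2 : block f (t + 2) x y = block f t x y)
    {x' : X} {y' : Y} (hx : x' ∈ (block f t x y).1) (hy : y' ∈ (block f t x y).2) :
    f x' y' = f x y := by
  obtain ⟨m1, m2⟩ := mem_block f t x y
  have h3 : rowClass f (block f t x y).1 (block f t x y).2 x = (block f t x y).1 ∧
      rowClass (fun y x => f x y) (block f t x y).2 (block f t x y).1 y = (block f t x y).2 := by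
    by_cases ht : Even t
    · have ht' : ¬ Even (t + 1) := by simpa [Nat.even_add_one] using ht
      rw [block_succ_of_not_even ht', h1] at h2
      rw [block_succ_of_even ht] at h1
      exact ⟨congrArg Prod.fst h1, congrArg Prod.snd h2⟩
    · have ht' : Even (t + 1) := by simpa [Nat.even_add_one] using ht
      rw [block_succ_of_even ht', h1] at h2
      rw [block_succ_of_not_even ht] at h1
      exact ⟨congrArg Prod.fst h2, congrArg Prod.snd h1⟩
  generalize block f t x y = b at hx hy m1 m2 h3
  obtain ⟨A, B⟩ := b
  have hmono : IsMonochromatic ((Matrix.of f).submatrix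
      (fun a : A => (a : X)) (fun b : B => (b : Y))) := by
    by_contra hmono
    refine hf ⟨A, B, fun a a' => transGen_rowRel_of_rowLink ?_, fun b b' => ?_, hmono⟩
    · have ha : (a : X) ∈ rowClass f A B x := h3.1 ▸ a.2
      have ha' : (a' : X) ∈ rowClass f A B x := h3.1 ▸ a'.2
      exact (transGen_rowLink_symm ha).trans ha'
    · have hb : (b : Y) ∈ rowClass (fun y x => f x y) B A y := h3.2 ▸ b.2
      have hb' : (b' : Y) ∈ rowClass (fun y x => f x y) B A y := h3.2 ▸ b'.2
      exact transGen_rowRel_of_rowLink (f := fun y x => f x y)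
        ((transGen_rowLink_symm hb).trans hb')
  exact hmono ⟨x', hx⟩ ⟨x, m1⟩ ⟨y', hy⟩ ⟨y, m2⟩

/-- Labels `L t x y` that the players can announce in turn, Al in the even rounds and Bob in the odd
ones, such that nothing but the value of `f` is revealed and that value is determined after `N`
rounds. -/
structure IsPrivateLabeling {Λ : Type*} (f : X → Y → Z) (N : ℕ) (L : ℕ → X → Y → Λ) : Prop where
  zero : ∀ x x' y y', L 0 x y = L 0 x' y'
  al : ∀ t, Even t → ∀ x y y', L t x y = L t x y' ↔ L (t + 1) x y = L (t + 1) x y'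
  bob : ∀ t, ¬ Even t → ∀ y x x', L t x y = L t x' y ↔ L (t + 1) x y = L (t + 1) x' y
  row : ∀ t x x' y, f x y = f x' y → L t x y = L t x' y
  col : ∀ t x y y', f x y = f x y' → L t x y = L t x y'
  val : ∀ x x' y y', L N x y = L N x' y' → f x y = f x' y'

/-- Blocks decrease in a finite order, so each sequence stabilizes, and `N` bounds the finitely many
times of stabilization. Blocks only get refined, which gives the backward halves of `al` and `bob`:
no label is forgotten. -/
theorem exists_isPrivateLabeling [Finite X] [Finite Y] (hf : ¬ ContainsForbidden f) :
    ∃ N, IsPrivateLabeling f N (block f) := by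
  have hstab : ∀ p : X × Y, ∃ n, ∀ m, n ≤ m → block f n p.1 p.2 = block f m p.1 p.2 := fun p =>
    WellFoundedGT.monotone_chain_condition
      (⟨fun t => OrderDual.toDual (block f t p.1 p.2),
        monotone_nat_of_le_succ fun t => block_succ_le f t p.1 p.2⟩ : ℕ →o (Set X × Set Y)ᵒᵈ)
  choose n hn using hstab
  obtain ⟨N, hN⟩ := (Set.finite_range n).bddAbove
  have hst : ∀ x y k, block f (N + k) x y = block f N x y := fun x y k => by
    have := hN ⟨(x, y), rfl⟩
    rw [← hn (x, y) _ (this.trans (Nat.le_add_right N k)), ← hn (x, y) _ this]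
  refine ⟨N, fun _ _ _ _ => rfl, fun t ht x y y' => ⟨fun h => ?_, block_eq_of_block_succ_eq⟩,
    fun t ht y x x' => ⟨fun h => ?_, block_eq_of_block_succ_eq⟩,
    fun t x x' y h => block_eq_of_row h t, fun t x y y' h => block_eq_of_col h t,
    fun x x' y y' h => ?_⟩
  · rw [block_succ_of_even ht, block_succ_of_even ht, h]
  · rw [block_succ_of_not_even ht, block_succ_of_not_even ht, h]
  · have hm := mem_block f N x y
    rw [h] at hm
    exact eq_of_block_stable hf (hst x' y' 1) (hst x' y' 2) hm.1 hm.2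

end Blocks

/-! ### The deterministic protocol -/

section ClassicalConstruction

variable {X Y Z Λ : Type*} {f : X → Y → Z} {N : ℕ} {L : ℕ → X → Y → Λ}

/-- Summing over sample points instead of values shows that the entropy depends only on the
partition induced by `W`. -/
lemma shannonEntropy_eq_sum_logb {Ω α : Type*} [Fintype Ω] (pr : Ω → ℝ) (W : Ω → α) :
    shannonEntropy pr W = ∑ ω, -(pr ω * Real.logb 2 (massAt pr W (W ω))) := by
  classical
  rw [shannonEntropy_eq_sum (s := Finset.univ.image W) (fun w hw => massAt_eq_zero fun ω h =>
    hw (Finset.mem_image.2 ⟨ω, Finset.mem_univ _, h⟩)),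
    ← Finset.sum_fiberwise_of_maps_to (t := Finset.univ.image W) (g := W)
      (fun ω _ => Finset.mem_image_of_mem _ (Finset.mem_univ _))]
  refine Finset.sum_congr rfl fun w _ => ?_
  rw [Finset.sum_congr rfl fun ω hω => by rw [(Finset.mem_filter.1 hω).2], Finset.sum_neg_distrib,
    ← Finset.sum_mul, Finset.sum_filter, negMulLogTwo]
  congr! 2

lemma shannonEntropy_congr {Ω α β : Type*} [Fintype Ω] (pr : Ω → ℝ) {W : Ω → α} {W' : Ω → β}
    (h : ∀ ω ω', W ω = W ω' ↔ W' ω = W' ω') : shannonEntropy pr W = shannonEntropy pr W' := by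
  classical
  rw [shannonEntropy_eq_sum_logb, shannonEntropy_eq_sum_logb]
  simp only [massAt, h]

/-- If `W` determines `U`, adjoining `U` does not refine the partitions, and the entropies cancel in
pairs. -/
lemma condMutualInfo_eq_zero_of_determined {Ω α β γ : Type*} [Fintype Ω] (pr : Ω → ℝ) {U : Ω → α}
    (V : Ω → β) {W : Ω → γ} (h : ∀ ω ω', W ω = W ω' → U ω = U ω') :
    condMutualInfo pr U V W = 0 := by
  unfold condMutualInfo
  rw [shannonEntropy_congr pr (W := fun ω => (U ω, W ω)) (W' := W) (fun ω ω' => by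
      simpa [Prod.ext_iff] using h ω ω'),
    shannonEntropy_congr pr (W := fun ω => (U ω, V ω, W ω)) (W' := fun ω => (V ω, W ω))
      (fun ω ω' => by
        simp only [Prod.ext_iff]
        exact ⟨And.right, fun h' => ⟨h ω ω' h'.2, h'⟩⟩)]
  ring

instance : Nonempty Player := ⟨Player.al⟩

lemma nonempty_stdSimplex (Q : Type*) [Fintype Q] [Nonempty Q] : Nonempty (stdSimplex ℝ Q) := by
  classical
  exact ⟨⟨_, single_mem_stdSimplex ℝ (Classical.arbitrary Q)⟩⟩

open Classical in
theorem IsPrivateLabeling.deterministicPrivate [Fintype X] [Fintype Y] [Nonempty X] [Nonempty Y]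
    [Finite Λ] (h : IsPrivateLabeling f N L) : DeterministicPrivate f := by
  obtain ⟨k, ⟨φ⟩⟩ := Finite.exists_equiv_fin Λ
  -- Unary code: the length of the message names the label.
  set enc : Λ → List Bool := fun l => List.replicate (φ l) true with henc
  have enc_inj : Function.Injective enc := fun l l' hl => by
    have := congrArg List.length hl
    simp only [henc, List.length_replicate] at this
    exact φ.injective (Fin.ext this)
  -- Round `s` announces the label of time `s + 1`; the label of time `0` is constant and need not
  -- be sent.
  set T : ℕ → X → Y → List (List Bool) := fun t x y =>
    (List.range t).map fun s => enc (L (s + 1) x y) with hT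
  have T_succ : ∀ t x y, T (t + 1) x y = T t x y ++ [enc (L (t + 1) x y)] := fun t x y => by
    simp [hT, List.range_succ]
  have T_inj : ∀ {t x x' y y'}, T t x y = T t x' y' → L t x y = L t x' y' := by
    intro t x x' y y' hTT
    cases t with
    | zero => exact h.zero _ _ _ _
    | succ t =>
      rw [T_succ, T_succ] at hTT
      have := (List.append_inj' hTT rfl).2
      simp only [List.cons.injEq, and_true] at this
      exact enc_inj this
  let P : ClassicalProtocol X Y Z :=
    { coinsAl := 1
      coinsBob := 1
      distAl := ⟨_, single_mem_stdSimplex ℝ 0⟩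
      distBob := ⟨_, single_mem_stdSimplex ℝ 0⟩
      rounds := N
      speaker := fun t => if Even t then Player.al else Player.bob
      -- Al does not know `y`, but any column that fits the messages gives the same next label. The
      -- value `[]` is never used on a transcript that occurs.
      msgAl := fun t x _ m => if hm : ∃ y, T t x y = m then enc (L (t + 1) x hm.choose) else []
      msgBob := fun t y _ m => if hm : ∃ x, T t x y = m then enc (L (t + 1) hm.choose y) else []
      outAl := fun x _ m =>
        if hm : ∃ y, T N x y = m then f x hm.choose else f x (Classical.arbitrary Y)
      outBob := fun y _ m =>
        if hm : ∃ x, T N x y = m then f hm.choose y else f (Classical.arbitrary X) y }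
  have htr : ∀ x y r s t, P.transcript x y r s t = T t x y := by
    intro x y r s t
    induction t with
    | zero => rfl
    | succ t ih =>
      rw [ClassicalProtocol.transcript, ih, T_succ]
      congr 2
      by_cases ht : Even t
      · have hm : ∃ y', T t x y' = T t x y := ⟨y, rfl⟩
        simp only [P, if_pos ht, dif_pos hm]
        rw [(h.al t ht _ _ _).1 (T_inj hm.choose_spec)]
      · have hm : ∃ x', T t x' y = T t x y := ⟨x, rfl⟩
        simp only [P, if_neg ht, dif_pos hm]
        rw [(h.bob t ht _ _ _).1 (T_inj hm.choose_spec)]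
  have hres : ∀ p x y r s, P.result p x y r s = f x y := by
    intro p x y r s
    cases p with
    | al =>
      have hm : ∃ y', T N x y' = T N x y := ⟨y, rfl⟩
      change P.outAl x r (P.transcript x y r s N) = _
      rw [htr]
      simp only [P, dif_pos hm]
      exact h.val _ _ _ _ (T_inj hm.choose_spec)
    | bob =>
      have hm : ∃ x', T N x' y = T N x y := ⟨x, rfl⟩
      change P.outBob y s (P.transcript x y r s N) = _
      rw [htr]
      simp only [P, dif_pos hm]
      exact h.val _ _ _ _ (T_inj hm.choose_spec)
  have T_row : ∀ {t x x' y}, f x y = f x' y → T t x y = T t x' y := fun {t x x' y} hf => by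
    simp only [hT, h.row _ x x' y hf]
  have T_col : ∀ {t x y y'}, f x y = f x y' → T t x y = T t x y' := fun {t x y y'} hf => by
    simp only [hT, h.col _ x y y' hf]
  have hdiv : ∀ t p μ, P.divulged f t p μ = 0 := by
    intro t p μ
    cases p with
    | al =>
      refine condMutualInfo_eq_zero_of_determined _ _ ?_
      rintro ⟨⟨x, y⟩, r, s⟩ ⟨⟨x', y'⟩, r', s'⟩ hW
      simp only [Prod.mk.injEq] at hW
      obtain ⟨rfl, hW⟩ := hW
      dsimp only
      rw [htr, htr, T_col hW, Subsingleton.elim (α := Fin 1) r r']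
    | bob =>
      refine condMutualInfo_eq_zero_of_determined _ _ ?_
      rintro ⟨⟨x, y⟩, r, s⟩ ⟨⟨x', y'⟩, r', s'⟩ hW
      simp only [Prod.mk.injEq] at hW
      obtain ⟨rfl, hW⟩ := hW
      dsimp only
      rw [htr, htr, T_row hW, Subsingleton.elim (α := Fin 1) s s']
  have := nonempty_stdSimplex (X × Y)
  refine ⟨P, ⟨rfl, rfl⟩, fun p x y => ?_, ?_⟩
  · unfold ClassicalProtocol.resultProb
    simp only [hres, if_true]
    rw [← Finset.sum_mul_sum, P.distAl.2.2, one_mul, sub_zero]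
  · unfold ClassicalProtocol.privacyLoss
    simp only [hdiv, EReal.coe_zero, iSup_const]

end ClassicalConstruction

/-! ### The quantum protocol -/

section QuantumConstruction

open Matrix

lemma vonNeumannEntropy_single {R : Type*} [Fintype R] [DecidableEq R] (r : R) (w : ℂ) :
    vonNeumannEntropy (diagonal (Pi.single r w)) = negMulLogTwo w.re := by
  rw [vonNeumannEntropy_diagonal, Fintype.sum_eq_single r]
  · simp
  · intro r' hr
    simp [hr]

/-- The register is in a basis state fixed by `C`, so it adds no entropy: `S(PC) = S(C)` and `S(PQC)
= S(QC)`. -/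
lemma quantumCondMutualInfo_eq_zero_of_determined {P Q C : Type*} [Fintype P] [Fintype Q]
    [Fintype C] [DecidableEq P] [DecidableEq Q] [DecidableEq C] (D : C → P) (w : Q × C → ℂ) :
    quantumCondMutualInfo
      (blockDiagonal fun i : Q × C => diagonal (Pi.single (D i.2) (w i))) = 0 := by
  have h : ∀ c, ∑ q, diagonal (Pi.single (D c) (w (q, c)))
      = diagonal (Pi.single (D c) (∑ q, w (q, c))) := by
    intro c
    ext i j
    rw [Matrix.sum_apply]
    by_cases hij : i = j
    · subst hij
      by_cases hi : i = D c
      · subst hi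
        simp
      · simp [hi]
    · simp [hij]
  rw [quantumCondMutualInfo_blockDiagonal]
  simp only [h, vonNeumannEntropy_single, trace_diagonal, Finset.sum_pi_single', Finset.mem_univ,
    if_true]
  ring

lemma quantumDivulged_eq_zero_of_determined {R O K Z : Type*} [Fintype R] [DecidableEq R]
    [Nonempty R] [Fintype O] [Fintype K] {g : O → K → Z} {d : O → K → R}
    (hd : ∀ o o' k, g o k = g o' k → d o k = d o' k) (μ : O → K → ℝ) :
    quantumDivulged g (fun o k => diagonal (Pi.single (d o k) 1)) μ = 0 := by
  classical
  -- Any `o` that produces the value will do, by `hd`; for values that do not occur with this `k`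
  -- the weight is zero and the default is harmless.
  set D : K × Set.range (fun a : O × K => g a.1 a.2) → R := fun c =>
    if h : ∃ o, g o c.1 = c.2 then d h.choose c.1 else Classical.arbitrary R with hD
  have hDd : ∀ o k (z : Set.range fun a : O × K => g a.1 a.2), (z : Z) = g o k →
      D (k, z) = d o k := by
    intro o k z hz
    have h : ∃ o, g o k = z := ⟨o, hz.symm⟩
    simp only [hD, dif_pos h]
    exact hd _ _ _ (h.choose_spec.trans hz)
  rw [← quantumCondMutualInfo_eq_zero_of_determined D
    (fun i : O × (K × Set.range fun a : O × K => g a.1 a.2) =>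
      if (i.2.2 : Z) = g i.1 i.2.1 then (μ i.1 i.2.1 : ℂ) else 0)]
  unfold quantumDivulged
  congr! 1
  ext ⟨r, o, k, z⟩ ⟨r', i⟩
  rw [of_apply, blockDiagonal_apply]
  by_cases hi : (o, k, z) = i
  · subst hi
    by_cases hz : (z : Z) = g o k
    · rw [if_pos ⟨rfl, hz⟩, if_pos rfl]
      dsimp only
      rw [if_pos hz, hDd o k z hz]
      by_cases hr : r = r'
      · subst hr
        by_cases hr' : r = d o k <;> simp [hr']
      · simp [hr]
    · rw [if_neg fun h => hz h.2, if_pos rfl]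
      simp [hz]
  · rw [if_neg fun h => hi h.1, if_neg hi]

lemma reducedState_single {n : ℕ} (S : Fin n → Prop) [DecidablePred S] (d : Fin n → Bool) :
    reducedState S (Pi.single d 1)
      = diagonal (Pi.single (fun q : {q // S q} => d q) 1) := by
  have hm : ∀ (a : Bits S) c, merge S a c = d ↔
      a = (fun q : {q // S q} => d q) ∧ c = fun q : {q // ¬ S q} => d q := by
    intro a c
    constructor
    · rintro rfl
      exact ⟨(restrict_merge a c).symm, funext fun q => (merge_of_not_mem a c q.2).symm⟩
    · rintro ⟨rfl, rfl⟩
      exact (Equiv.piEquivPiSubtypeProd S fun _ => Bool).symm_apply_apply d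
  ext a b
  rw [reducedState, of_apply, Fintype.sum_eq_single fun q : {q // ¬ S q} => d q]
  · by_cases ha : a = fun q : {q // S q} => d q
    · by_cases hb : b = fun q : {q // S q} => d q
      · simp [Pi.single_apply, hm, ha, hb]
      · simp [Pi.single_apply, hm, ha, hb, Ne.symm hb]
    · simp [Pi.single_apply, hm, ha, diagonal_apply]
  · intro c hc
    simp [hm, hc]

/-- The map `u i ↦ v i` is a bijection between the two ranges, and on a finite type it extends to a
permutation. The equivalence in `h` is what makes a round reversible. -/
lemma exists_perm_apply_eq {ι β : Type*} [Finite β] {u v : ι → β}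
    (h : ∀ i j, u i = u j ↔ v i = v j) : ∃ σ : Equiv.Perm β, ∀ i, σ (u i) = v i := by
  classical
  have := Fintype.ofFinite β
  let g : {b // b ∈ Set.range u} → {b // b ∈ Set.range v} := fun b => ⟨v b.2.choose, _, rfl⟩
  have hg : ∀ i, g ⟨u i, i, rfl⟩ = ⟨v i, i, rfl⟩ := fun i => Subtype.ext
    ((h _ _).1 (Exists.choose_spec (⟨i, rfl⟩ : ∃ j, u j = u i)))
  have hbij : Function.Bijective g := by
    constructor
    · rintro ⟨_, i, rfl⟩ ⟨_, j, rfl⟩ hij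
      rw [hg, hg] at hij
      exact Subtype.ext ((h i j).2 (congrArg Subtype.val hij))
    · rintro ⟨_, i, rfl⟩
      exact ⟨⟨u i, i, rfl⟩, hg i⟩
  refine ⟨(Equiv.ofBijective g hbij).extendSubtype, fun i => ?_⟩
  rw [Equiv.extendSubtype_apply_of_mem _ _ ⟨i, rfl⟩, Equiv.ofBijective_apply, hg]

/-- A player who owns all qubits can map basis states to basis states. -/
lemma exists_unitary_applyLocal_single {ι : Type*} {n : ℕ} {S : Fin n → Prop} [DecidablePred S]
    (hS : ∀ q, S q) {u v : ι → Fin n → Bool} (h : ∀ i j, u i = u j ↔ v i = v j) :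
    ∃ U : unitaryGroup (Bits S) ℂ, ∀ i,
      applyLocal S U.1 (Pi.single (u i) 1) = Pi.single (v i) 1 := by
  have hinj : ∀ {c d : Fin n → Bool},
      ((fun q : {q // S q} => c q) = fun q : {q // S q} => d q) ↔ c = d := by
    intro c d
    exact ⟨fun h => funext fun q => congrFun h ⟨q, hS q⟩, fun h => by rw [h]⟩
  obtain ⟨σ, hσ⟩ := exists_perm_apply_eq (u := fun i (q : {q // S q}) => u i q)
    (v := fun i (q : {q // S q}) => v i q) fun i j => by rw [hinj, hinj, h]
  -- The permutation matrix that sends the basis state `a` to `σ a`.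
  refine ⟨⟨(1 : Matrix (Bits S) (Bits S) ℂ).submatrix id σ, ?_⟩, fun i => ?_⟩
  · rw [mem_unitaryGroup_iff', star_eq_conjTranspose, conjTranspose_submatrix, conjTranspose_one,
      ← submatrix_mul _ _ _ _ _ Function.bijective_id, one_mul, submatrix_one_equiv]
  · ext c
    rw [applyLocal, Fintype.sum_eq_single fun q : {q // S q} => u i q]
    · have : merge S (fun q : {q // S q} => u i q) (fun q => c q) = u i :=
        funext fun q => merge_of_mem _ _ (hS q)
      rw [this]
      change (1 : Matrix (Bits S) (Bits S) ℂ) _ (σ _) * _ = _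
      rw [hσ, one_apply]
      simp only [id, hinj, Pi.single_eq_same, mul_one, Pi.single_apply]
    · intro a ha
      have : merge S a (fun q => c q) ≠ u i := by
        rintro h
        rw [← h, restrict_merge] at ha
        exact ha rfl
      simp [this]

variable {X Y Z Λ : Type*} {f : X → Y → Z} {N : ℕ} {L : ℕ → X → Y → Λ}

-- The register holds two copies of the current label and is passed back and forth. For a fixed
-- input of the speaker, successive labels determine each other, so a round is a permutation of
-- basis states. At the end each player keeps one copy.
open Classical in
theorem IsPrivateLabeling.quantumPrivate [Fintype X] [Fintype Y] [Nonempty X] [Nonempty Y]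
    [Finite Λ] (h : IsPrivateLabeling f N L) : QuantumPrivate f 0 := by
  have := Fintype.ofFinite Λ
  let e : Fin (Fintype.card (Λ × Bool)) ≃ Λ × Bool := (Fintype.equivFin _).symm
  set l₀ : Λ := L 0 (Classical.arbitrary X) (Classical.arbitrary Y) with hl₀
  -- One-hot code, except that the initial label `l₀` is all zeros, so that the protocol starts in
  -- `|0⋯0⟩`. The Boolean in `Λ × Bool` numbers the copies.
  set D : ℕ → X → Y → Fin (Fintype.card (Λ × Bool)) → Bool := fun t x y q =>
    decide (L t x y = (e q).1 ∧ L t x y ≠ l₀) with hD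
  have D_zero : ∀ x y, D 0 x y = fun _ => false := by
    intro x y
    funext q
    simp [hD, h.zero x (Classical.arbitrary X) y (Classical.arbitrary Y), hl₀]
  -- A single copy already determines the label, which is all that a player has in the end.
  have D_inj : ∀ (b : Bool) {t x x' y y'}, (∀ q, (e q).2 = b → D t x y q = D t x' y' q) →
      L t x y = L t x' y' := by
    intro b t x x' y y' hq
    have h1 := hq (e.symm (L t x y, b)) (by simp)
    have h2 := hq (e.symm (L t x' y', b)) (by simp)
    simp only [hD, Equiv.apply_symm_apply, decide_eq_decide] at h1 h2
    by_cases hl : L t x y = l₀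
    · by_contra hne
      exact hne (h2.2 ⟨trivial, fun h => hne (hl.trans h.symm)⟩).1
    · exact (h1.1 ⟨trivial, hl⟩).1.symm
  have D_iff : ∀ {t x x' y y'}, D t x y = D t x' y' ↔ L t x y = L t x' y' := by
    intro t x x' y y'
    exact ⟨fun hDD => D_inj true fun q _ => congrFun hDD q, fun hL => by simp only [hD, hL]⟩
  let speaker : ℕ → Player := fun t => if Even t then Player.al else Player.bob
  -- Before time `N` the next speaker owns every qubit; from then on the copy `true` is Bob's and
  -- `false` is Al's.
  let owner : ℕ → Fin (Fintype.card (Λ × Bool)) → Player := fun t q =>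
    if t < N then speaker t else if (e q).2 then Player.bob else Player.al
  have hAl : ∀ t x, ∃ U : unitaryGroup (Bits fun q => owner t q = Player.al) ℂ, t < N → Even t →
      ∀ y, applyLocal _ U.1 (Pi.single (D t x y) 1) = Pi.single (D (t + 1) x y) 1 := by
    intro t x
    by_cases ht : t < N ∧ Even t
    · obtain ⟨U, hU⟩ := exists_unitary_applyLocal_single (S := fun q => owner t q = Player.al)
        (fun q => by simp only [owner, speaker, if_pos ht.1, if_pos ht.2])
        (u := D t x) (v := D (t + 1) x) fun y y' => by rw [D_iff, D_iff, h.al t ht.2]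
      exact ⟨U, fun _ _ => hU⟩
    · exact ⟨1, fun h1 h2 => absurd ⟨h1, h2⟩ ht⟩
  have hBob : ∀ t y, ∃ U : unitaryGroup (Bits fun q => owner t q = Player.bob) ℂ, t < N →
      ¬ Even t →
      ∀ x, applyLocal _ U.1 (Pi.single (D t x y) 1) = Pi.single (D (t + 1) x y) 1 := by
    intro t y
    by_cases ht : t < N ∧ ¬ Even t
    · obtain ⟨U, hU⟩ := exists_unitary_applyLocal_single (S := fun q => owner t q = Player.bob)
        (fun q => by simp only [owner, speaker, if_pos ht.1, if_neg ht.2])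
        (u := fun x => D t x y) (v := fun x => D (t + 1) x y)
        fun x x' => by rw [D_iff, D_iff, h.bob t ht.2]
      exact ⟨U, fun _ _ => hU⟩
    · exact ⟨1, fun h1 h2 => absurd ⟨h1, h2⟩ ht⟩
  choose opAl hopAl using hAl
  choose opBob hopBob using hBob
  let P : QuantumProtocol X Y Z :=
    { qubits := Fintype.card (Λ × Bool)
      rounds := N
      speaker := speaker
      owner := owner
      -- Vacuous before time `N`, when nobody but the speaker owns a qubit; afterwards ownership is
      -- constant.
      owner_succ := fun t q hq => by
        by_cases ht : t < N
        · exact absurd (by simp only [owner, if_pos ht]) hq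
        · simp only [owner, if_neg ht, if_neg (fun h => ht (Nat.lt_of_succ_lt h) : ¬ t + 1 < N)]
      opAl := opAl
      opBob := opBob
      outAl := fun x c => if hc : ∃ y, (fun q : {q // owner N q = Player.al} => D N x y q) = c then
        f x hc.choose else f x (Classical.arbitrary Y)
      outBob := fun y c =>
        if hc : ∃ x, (fun q : {q // owner N q = Player.bob} => D N x y q) = c then
          f hc.choose y else f (Classical.arbitrary X) y }
  have hstate : ∀ x y t, t ≤ N → P.state x y t = Pi.single (D t x y) 1 := by
    intro x y t ht
    induction t with
    | zero => rw [D_zero]; rfl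
    | succ t ih =>
      have ih := ih (by omega)
      by_cases he : Even t
      · have hs : P.speaker t = Player.al := if_pos he
        rw [P.state_succ_of_al hs, embedLocal_mulVec, ih]
        exact hopAl t x ht he y
      · have hs : P.speaker t = Player.bob := if_neg he
        rw [P.state_succ_of_bob hs, embedLocal_mulVec, ih]
        exact hopBob t y ht he x
  have hres : ∀ p x y, P.result p x y (D N x y) = f x y := by
    intro p x y
    cases p with
    | al =>
      have hc : ∃ y', (fun q : {q // owner N q = Player.al} => D N x y' q)
        = fun q : {q // owner N q = Player.al} => D N x y q := ⟨y, rfl⟩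
      refine (dif_pos hc).trans (h.val _ _ _ _ (D_inj false fun q hq => ?_))
      exact congrFun hc.choose_spec ⟨q, by simp [owner, hq]⟩
    | bob =>
      have hc : ∃ x', (fun q : {q // owner N q = Player.bob} => D N x' y q)
        = fun q : {q // owner N q = Player.bob} => D N x y q := ⟨x, rfl⟩
      refine (dif_pos hc).trans (h.val _ _ _ _ (D_inj true fun q hq => ?_))
      exact congrFun hc.choose_spec ⟨q, by simp [owner, hq]⟩
  have hdiv : ∀ (t : Fin (P.rounds + 1)) p μ, P.divulged f t p μ = 0 := by
    intro t p μ
    have ht : (t : ℕ) ≤ N := Nat.lt_succ_iff.1 t.2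
    cases p with
    | al =>
      unfold QuantumProtocol.divulged
      simp only [hstate _ _ _ ht, reducedState_single]
      refine quantumDivulged_eq_zero_of_determined
        (d := fun y x (q : {q // P.owner t q = Player.al}) => D t x y q) (fun y y' x hf => ?_) _
      simp only [D_iff.2 (h.col t x y y' hf)]
    | bob =>
      unfold QuantumProtocol.divulged
      simp only [hstate _ _ _ ht, reducedState_single]
      refine quantumDivulged_eq_zero_of_determined
        (d := fun x y (q : {q // P.owner t q = Player.bob}) => D t x y q) (fun x x' y hf => ?_) _
      simp only [D_iff.2 (h.row t x x' y hf)]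
  have := nonempty_stdSimplex (X × Y)
  refine ⟨P, fun p x y => ?_, ?_⟩
  · unfold QuantumProtocol.resultProb
    rw [Fintype.sum_eq_single (D N x y), if_pos (hres p x y), hstate x y P.rounds le_rfl]
    · simp [P]
    · intro c hc
      rw [hstate x y P.rounds le_rfl]
      simp [P, hc]
  · unfold QuantumProtocol.privacyLoss
    simp only [hdiv, EReal.coe_zero, iSup_const]

end QuantumConstruction

/-! ### The equivalences -/

theorem mainTheorem4 {X Y Z : Type*} [Fintype X] [Fintype Y] [Nonempty X] [Nonempty Y]
    (f : X → Y → Z) :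
    (ContainsForbidden f →
      ∀ (ε : ℝ), ε < 1 / 2 → ∀ (P : QuantumProtocol X Y Z) (p : Player),
        P.Computes p f ε → P.privacyLoss f ≠ 0) ∧
    List.TFAE [
      ¬ ContainsForbidden f,
      DeterministicPrivate f,
      ClassicalPrivate f 0,
      ∃ ε : ℝ, ε < 1 / 2 ∧ ClassicalPrivate f ε,
      QuantumPrivate f 0,
      ∃ ε : ℝ, ε < 1 / 2 ∧ QuantumPrivate f ε] := by
  refine ⟨fun hf ε hε P p hP => not_computes_of_containsForbidden hf hε hP, ?_⟩
  tfae_have 1 → 2 := fun hf => by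
    obtain ⟨N, h⟩ := exists_isPrivateLabeling hf
    exact h.deterministicPrivate
  tfae_have 2 → 3 := fun ⟨P, _, hP, hloss⟩ => ⟨P, hP, hloss⟩
  tfae_have 3 → 4 := fun h => ⟨0, by norm_num, h⟩
  tfae_have 4 → 1 := fun ⟨ε, hε, h⟩ => not_containsForbidden_of_classicalPrivate hε h
  tfae_have 1 → 5 := fun hf => by
    obtain ⟨N, h⟩ := exists_isPrivateLabeling hf
    exact h.quantumPrivate
  tfae_have 5 → 6 := fun h => ⟨0, by norm_num, h⟩
  tfae_have 6 → 1 := fun ⟨ε, hε, P, hP, hloss⟩ hf =>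
    not_computes_of_containsForbidden hf hε (hP Player.al) hloss
  tfae_finish
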